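/- **Setting.** A graph $G$ has finite sets of vertices $V$, edges $E$ and half-edges $H$; every edge consists of two distinct half-edges, every half-edge is incident to one vertex (multiple edges and self-loops are allowed). Put $n=|V|$, $m=|E|$. An *orientation* of $G$ is a generator $o$ of $\det\mathbb Z^{V}\otimes\bigotimes_{e}\det\mathbb Z^{H(e)}\cong\mathbb Z$, i.e. an order of the vertices and a direction of each edge, up to sign. Let $H_1(G)\cong\mathbb Z^{\ell}$ be the cycle space, where $\ell$ is the loop number. For an ordered basis $\mathcal C=(C_1,\dots,C_\ell)$ of $H_1(G)$, written as an $m\times \ell$ matrix, let $\Lambda_{\mathcal C}=\mathcal C^{\mathsf T}\operatorname{diag}(x_e)_{e\in E}\,\mathcal C$, and put $$\phi_G=\frac{1}{\sqrt{\det\Lambda_{\mathcal C}}}\operatorname{Pf}\bigl(d\Lambda_{\mathcal C}\cdot\Lambda_{\mathcal C}^{-1}\cdot d\Lambda_{\mathcal C}\bigr)\ \text{ if }\ell\text{ is even},\qquad \phi_G=0\ \text{ if }\ell\text{ is odd},$$ a form of degree $\ell$ on the open simplex $\sigma_G=\{[x_{e_1}:\dots:x_{e_m}]: x_e>0\}\subset\mathbb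 P(\mathbb R^E)$. The simplex is oriented by an order $e_1,\dots,e_m$ of the edges, so that $dx_{e_2}\wedge\dots\wedge dx_{e_m}$ is positive in the chart $x_{e_1}=1$. The integral over $\sigma_G$ of a form of degree other than $m-1$ is zero, and so is the integral if $E=\emptyset$. For connected $G$, identify $\det\mathbb Z^V\otimes\bigotimes_e\det\mathbb Z^{H(e)}\cong\det\mathbb Z^E\otimes\det H_1(G)$ by $$v_1\wedge\dots\wedge v_n\otimes\bigotimes_e o_e\ \mapsto\ \det(C_1\,\cdots\,C_\ell\,P_2\,\cdots\,P_n)\cdot e_1\wedge\dots\wedge e_m\otimes C_1\wedge\dots\wedge C_\ell,$$ where $P_k$ is any 1-chain with boundary $v_k-v_1$ (the boundary of an edge is head minus tail) and the rows of the matrix are the coefficients of $o_{e_1},\dots,o_{e_m}$. If the oriented graph $(G,o)$ corresponds to $s\cdot e_1\wedge\dots\wedge e_m\otimes C_1\wedge\dots\wedge C_\ell$ with $s=\pm1$, put $$I_{(G,o)}(1)=\frac{s}{(-2\pi)^{\ell/2}}\int_{\sigma_G}\phi_G .$$ Let $\mathcal{GC}_3$ be the $\mathbb Q$-vector space spanned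 by the connected oriented graphs with at least three half-edges at every vertex, modulo $(G,o)\sim(G',\varphi_*o)$ for isomorphisms $\varphi\colon G\cong G'$, and $(G,o)\sim-(G,-o)$. It is bigraded by $\ell$ and by the degree $k=m-3\ell$. Let $\mathsf{GC}_3=\prod_{\ell,k}\operatorname{gr}_{\ell,k}\mathcal{GC}_3$, paired with $\mathcal{GC}_3$ by the bilinear extension of: $\langle G,G'\rangle=|\mathrm{Aut}\,G|$ if $G\sim G'\not\sim0$, $\langle G,G'\rangle=-|\mathrm{Aut}\,G|$ if $G\sim-G'$ and $G\not\sim0$, and $\langle G,G'\rangle=0$ otherwise; here $\mathrm{Aut}\,G$ is the group of all automorphisms of the underlying half-edge graph. The dipole $D_m$ has vertices $0<1$ and $m$ edges, all directed from $0$ to $1$. **Corollary 5.3.** 1. For every graph $G$ (connected or not), every order of its edges and every cycle basis, the integral $\int_{\sigma_G}\phi_G$ converges absolutely. 2. For every connected oriented graph $(G,o)$, the number $I_{(G,o)}(1)$ does not depend on the choices made (vertex order, edge directions, edge order, cycle basis, chains $P_k$). On $\mathcal{GC}_3$ it induces a well-defined $\mathbb Q$-linear map $I(1)\colon\mathcal{GC}_3\to\mathbb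 R$, $X\mapsto I_X(1)$, and for all $X\in\mathcal{GC}_3$ $$I_X(1)=\langle X,\mathrm{MC}_{\mathrm{dip}}\rangle,\qquad \mathrm{MC}_{\mathrm{dip}}=\sum_{i=1}^\infty\frac{D_{2i+1}}{2\cdot(2i+1)!}\in\mathsf{GC}_3 .$$ 3. Let $G$ be a connected oriented graph. Then $I_G(1)\in\{1,-1\}$ if and only if its underlying graph is isomorphic to a dipole $D_{2i+1}$, $i\ge0$, of even loop number $2i$; otherwise $I_G(1)=0$. If $(G,o)\cong D_{2i+1}$ as oriented graphs then $I_{(G,o)}(1)=1$, and if $(G,-o)\cong D_{2i+1}$ then $I_{(G,o)}(1)=-1$. (The single edge $D_1$ is not in $\mathcal{GC}_3$.) If $G$ is not connected and has no isolated vertices, then $\int_{\sigma_G}\phi_G=0$ for every order of the edges and every cycle basis. -/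

import Mathlib

noncomputable section

namespace OddGC

/-! ### Graphs, frames, orientations -/

/-- A finite graph given by vertices, edges and half-edges. Every edge consists of exactly two
distinct half-edges (`flip` exchanges them), every half-edge is incident to one vertex. Multiple
edges and self-loops are allowed. -/
structure HGraph where
  V : Type
  E : Type
  H : Type
  [finV : Fintype V]
  [finE : Fintype E]
  [finH : Fintype H]
  [decV : DecidableEq V]
  [decE : DecidableEq E]
  [decH : DecidableEq H]
  /-- the vertex to which a half-edge is attached -/
  vert : H → V
  /-- the edge to which a half-edge belongs -/
  edge : H → E
  /-- the other half of the same edge -/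
  flip : H → H
  flip_flip : ∀ h, flip (flip h) = h
  flip_ne : ∀ h, flip h ≠ h
  edge_surj : ∀ e, ∃ h, edge h = e
  edge_eq_iff : ∀ h h', edge h = edge h' ↔ h' = h ∨ h' = flip h

attribute [instance] HGraph.finV HGraph.finE HGraph.finH HGraph.decV HGraph.decE HGraph.decH

namespace HGraph

/-- Connected graphs are non-empty, and any two vertices are joined by a path of edges. -/
def Connected (G : HGraph) : Prop :=
  Nonempty G.V ∧ ∀ u v : G.V,
    Relation.ReflTransGen (fun a b => ∃ h, G.vert h = a ∧ G.vert (G.flip h) = b) u v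

/-- The number of half-edges at a vertex. -/
def valence (G : HGraph) (v : G.V) : ℕ := Fintype.card {h : G.H // G.vert h = v}

/-- A direction of all edges: the choice of the half-edge at the tail of each edge. -/
structure Direction (G : HGraph) where
  tail : G.E → G.H
  edge_tail : ∀ e, G.edge (tail e) = e

/-- A total order `v₁ < ⋯ < vₙ` of the vertices, with a direction of every edge. It stands for the
generator `v₁ ∧ ⋯ ∧ vₙ ⊗ ⨂ₑ (tail e ∧ head e)` of `det ℤ^V ⊗ ⨂ₑ det ℤ^{H(e)}`. -/
structure Frame (G : HGraph) where
  order : Fin (Fintype.card G.V) ≃ G.V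
  dir : G.Direction

variable {G : HGraph}

/-- The sign relating the generators of `det ℤ^V ⊗ ⨂ₑ det ℤ^{H(e)}` given by two frames. -/
def relSign (d d' : G.Frame) : ℤˣ :=
  Equiv.Perm.sign (d.order.trans d'.order.symm) *
    ∏ e : G.E, (if d.dir.tail e = d'.dir.tail e then 1 else -1)

theorem tail_cases (d d' : G.Direction) (e : G.E) :
    d'.tail e = d.tail e ∨ d'.tail e = G.flip (d.tail e) :=
  (G.edge_eq_iff _ _).1 (by rw [d.edge_tail, d'.edge_tail])

theorem relSign_trans (d d' d'' : G.Frame) :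
    relSign d d'' = relSign d d' * relSign d' d'' := by
  unfold relSign
  have h1 : d.order.trans d''.order.symm =
      (d.order.trans d'.order.symm).trans (d'.order.trans d''.order.symm) := by
    ext i; simp
  rw [h1, Equiv.Perm.sign_trans, mul_mul_mul_comm, ← Finset.prod_mul_distrib]
  congr 1
  · rw [mul_comm]
  · refine Finset.prod_congr rfl fun e _ => ?_
    have hne := G.flip_ne (d.dir.tail e)
    rcases tail_cases d.dir d'.dir e with h | h <;>
      rcases tail_cases d.dir d''.dir e with h' | h' <;>
      simp [h, h', hne, hne.symm]

/-- An orientation, i.e. one of the two invertible elements `o` of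
`det ℤ^V ⊗ ⨂ₑ det ℤ^{H(e)} ≅ ℤ`. It is recorded through its coefficient `coeff d = ± 1` with respect
to the generator given by each frame `d`. -/
@[ext]
structure Orientation (G : HGraph) where
  coeff : G.Frame → ℤˣ
  coeff_eq : ∀ d d', coeff d' = relSign d d' * coeff d

instance : Neg (Orientation G) where
  neg o := ⟨fun d => -o.coeff d, fun d d' => by rw [o.coeff_eq d d', mul_neg]⟩

/-- The orientation that is represented by a frame. -/
def Frame.orientation (d₀ : G.Frame) : Orientation G where
  coeff d := relSign d₀ d
  coeff_eq d d' := by rw [relSign_trans d₀ d d', mul_comm]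

/-- An isomorphism of graphs: bijections of half-edges and vertices that preserve the edge
partition (so that they induce a bijection of edges) and the incidences. -/
@[ext]
structure Iso (G G' : HGraph) where
  onV : G.V ≃ G'.V
  onE : G.E ≃ G'.E
  onH : G.H ≃ G'.H
  vert_onH : ∀ h, G'.vert (onH h) = onV (G.vert h)
  edge_onH : ∀ h, G'.edge (onH h) = onE (G.edge h)

def Iso.symm {G G' : HGraph} (φ : Iso G G') : Iso G' G where
  onV := φ.onV.symm
  onE := φ.onE.symm
  onH := φ.onH.symm
  vert_onH h := by rw [Equiv.eq_symm_apply, ← φ.vert_onH, Equiv.apply_symm_apply]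
  edge_onH h := by rw [Equiv.eq_symm_apply, ← φ.edge_onH, Equiv.apply_symm_apply]

def Iso.trans {G G' G'' : HGraph} (φ : Iso G G') (ψ : Iso G' G'') : Iso G G'' where
  onV := φ.onV.trans ψ.onV
  onE := φ.onE.trans ψ.onE
  onH := φ.onH.trans ψ.onH
  vert_onH h := by simp [ψ.vert_onH, φ.vert_onH]
  edge_onH h := by simp [ψ.edge_onH, φ.edge_onH]

/-- The order of the automorphism group of the graph (orientations are ignored). -/
def autCard (G : HGraph) : ℕ := Nat.card (Iso G G)

theorem autCard_eq_of_iso {G G' : HGraph} (φ : Iso G G') : G.autCard = G'.autCard := by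
  refine Nat.card_congr
    { toFun := fun α => (φ.symm.trans α).trans φ
      invFun := fun α => (φ.trans α).trans φ.symm
      left_inv := fun α => ?_
      right_inv := fun α => ?_ } <;>
  · ext x <;> simp [Iso.trans, Iso.symm]

/-- The frame `d'` of `G'` is the image of the frame `d` of `G`. -/
def Iso.MapsFrame {G G' : HGraph} (φ : Iso G G') (d : G.Frame) (d' : G'.Frame) : Prop :=
  (∀ (i : Fin (Fintype.card G.V)) (j : Fin (Fintype.card G'.V)), (i : ℕ) = j →
    φ.onV (d.order i) = d'.order j) ∧
  ∀ e, φ.onH (d.dir.tail e) = d'.dir.tail (φ.onE e)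

/-- `φ_* o = o'`. -/
def Iso.MapsOrientation {G G' : HGraph} (φ : Iso G G') (o : Orientation G)
    (o' : Orientation G') : Prop :=
  ∀ d d', φ.MapsFrame d d' → o'.coeff d' = o.coeff d

/-! ### Cycle space -/

/-- The group of 1-chains `C₁(G) = ⨁ₑ det ℤ^{H(e)}`, realised as the antisymmetric functions on
half-edges: `c h` is the coefficient of `h ∧ flip h`. -/
def C1 (G : HGraph) : Submodule ℤ (G.H → ℤ) where
  carrier := {c | ∀ h, c (G.flip h) = -c h}
  add_mem' := fun {a b} ha hb h => by
    have h1 := ha h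
    have h2 := hb h
    simp only [Pi.add_apply]; omega
  zero_mem' := fun h => by simp
  smul_mem' := fun r a ha h => by
    have h1 := ha h
    simp only [Pi.smul_apply, h1, smul_neg]

/-- The boundary map, head minus tail: `∂ (h ∧ flip h) = vert (flip h) - vert h`. -/
def boundary (G : HGraph) : (G.H → ℤ) →ₗ[ℤ] (G.V → ℤ) where
  toFun c v := -∑ h : G.H, if G.vert h = v then c h else 0
  map_add' a b := by
    ext v
    simp only [Pi.add_apply]
    rw [← neg_add, ← Finset.sum_add_distrib]
    congr 1
    refine Finset.sum_congr rfl fun h _ => ?_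
    split_ifs <;> simp
  map_smul' r a := by
    ext v
    simp [Finset.mul_sum]

/-- The cycle space `H₁(G) = ker (∂ : C₁(G) → ℤ^V)`. -/
def H1 (G : HGraph) : Submodule ℤ (G.H → ℤ) := G.C1 ⊓ LinearMap.ker G.boundary

/-- The loop number, the rank of `H₁(G)`; for connected graphs it is `|E| - |V| + 1`. -/
def loops (G : HGraph) : ℕ := Module.finrank ℤ G.H1

/-- An ordered basis of the cycle space. -/
abbrev CycleBasis (G : HGraph) : Type := Module.Basis (Fin G.loops) ℤ G.H1

/-- An ordering `e₁, …, eₘ` of the edges. -/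
abbrev EdgeOrder (G : HGraph) : Type := Fin (Fintype.card G.E) ≃ G.E

/-- The degree of a graph, `|E| - 3 ℓ`. -/
def degree (G : HGraph) : ℤ := (Fintype.card G.E : ℤ) - 3 * G.loops

end HGraph

/-! ### Differential forms and the Pfaffian form -/

/-- Differential forms (of mixed degree, without a regularity condition) on a real vector space:
a point is sent to an element of the exterior algebra of the cotangent space. -/
abbrev DForm (W : Type) [AddCommGroup W] [Module ℝ W] : Type :=
  W → ExteriorAlgebra ℝ (Module.Dual ℝ W)

/-- Pullback of a differential form along an affine map (whose derivative is its linear part). -/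
def DForm.pullback {U W : Type} [AddCommGroup U] [Module ℝ U] [AddCommGroup W] [Module ℝ W]
    (f : U →ᵃ[ℝ] W) (ω : DForm W) : DForm U :=
  fun u => ExteriorAlgebra.map f.linear.dualMap (ω (f u))

/-- The value `ω(∂₁, …, ∂ₖ)`, i.e. the coefficient of `dy₁ ∧ ⋯ ∧ dyₖ`, of an element of the
exterior algebra on the dual of `ℝᵏ`. Components of degree other than `k` contribute zero. -/
def topCoeff (k : ℕ) : ExteriorAlgebra ℝ (Module.Dual ℝ (Fin k → ℝ)) →ₗ[ℝ] ℝ :=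
  ExteriorAlgebra.liftAlternating
    (Pi.single k ((Matrix.detRowAlternating (n := Fin k) (R := ℝ)).compLinearMap
      (LinearMap.pi fun j => Module.Dual.eval ℝ (Fin k → ℝ) (Pi.single j 1))))

/-- The Pfaffian of a square matrix of size `l = 2 n`,
`(2ⁿ n!)⁻¹ ∑_π sgn π · M_{π(1)π(2)} ⋯ M_{π(2n-1)π(2n)}`, and zero if `l` is odd. It is used for
matrices whose entries commute (differential forms of even degree). -/
def pfaffian {R : Type*} [Ring R] [Algebra ℝ R] {l : ℕ} (M : Matrix (Fin l) (Fin l) R) : R :=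
  if Even l then
    ((2 : ℝ) ^ (l / 2) * (Nat.factorial (l / 2) : ℝ))⁻¹ •
      ∑ π : Equiv.Perm (Fin l), ((Equiv.Perm.sign π : ℤˣ) : ℤ) •
        (List.ofFn fun i : Fin (l / 2) =>
          M (π ⟨2 * (i : ℕ), by have := i.2; omega⟩)
            (π ⟨2 * (i : ℕ) + 1, by have := i.2; omega⟩)).prod
  else 0

/-- The vector space of symmetric real `l × l` matrices. -/
def SymMat (l : ℕ) : Submodule ℝ (Matrix (Fin l) (Fin l) ℝ) where
  carrier := {X | X.IsSymm}
  add_mem' := fun ha hb => Matrix.IsSymm.add ha hb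
  zero_mem' := Matrix.isSymm_zero
  smul_mem' := fun r _ ha => Matrix.IsSymm.smul ha r

/-- The matrix `dX` of the differentials of the coordinates `X_{ij}` on symmetric matrices. -/
def dX (l : ℕ) : Matrix (Fin l) (Fin l) (ExteriorAlgebra ℝ (Module.Dual ℝ (SymMat l))) :=
  Matrix.of fun i j =>
    ExteriorAlgebra.ι ℝ ((Matrix.entryLinearMap ℝ ℝ i j).comp (SymMat l).subtype)

/-- The Pfaffian form `φ_X = (det X)^{-1/2} Pf (dX · X⁻¹ · dX)` on positive definite symmetric
matrices (only its values at such matrices are meaningful). -/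
def pfaffianForm (l : ℕ) : DForm (SymMat l) := fun X =>
  (Real.sqrt (X : Matrix (Fin l) (Fin l) ℝ).det)⁻¹ •
    pfaffian (dX l * ((X : Matrix (Fin l) (Fin l) ℝ)⁻¹).map (algebraMap ℝ _) * dX l)

namespace HGraph

variable {G : HGraph}

/-- The edge-cycle matrix `𝒞`, whose columns are the basis cycles. -/
def cycleMatrix (t : G.Direction) (C : G.CycleBasis) : Matrix G.E (Fin G.loops) ℝ :=
  Matrix.of fun e j => (((C j : G.H → ℤ) (t.tail e) : ℤ) : ℝ)

/-- The dual Laplacian `Λ(x) = 𝒞ᵀ · diag(x) · 𝒞`, as a linear map in the edge variables. -/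
def dualLaplacian (t : G.Direction) (C : G.CycleBasis) : (G.E → ℝ) →ₗ[ℝ] SymMat G.loops where
  toFun x := ⟨(cycleMatrix t C).transpose * Matrix.diagonal x * cycleMatrix t C, by
    change Matrix.IsSymm _
    simp [Matrix.IsSymm, Matrix.transpose_mul, Matrix.mul_assoc]⟩
  map_add' x y := by
    ext1
    have h : Matrix.diagonal (x + y) = Matrix.diagonal x + Matrix.diagonal y :=
      (Matrix.diagonal_add x y).symm
    change (cycleMatrix t C).transpose * Matrix.diagonal (x + y) * cycleMatrix t C = _
    rw [h, Matrix.mul_add, Matrix.add_mul]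
    rfl
  map_smul' r x := by
    ext1
    simp [Matrix.diagonal_smul]

/-- The Pfaffian form `φ_G = Λ^* φ` of a graph, as a (projective) form on the positive orthant of
`ℝ^E`. -/
def graphForm (t : G.Direction) (C : G.CycleBasis) : DForm (G.E → ℝ) :=
  (pfaffianForm G.loops).pullback (dualLaplacian t C).toAffineMap

/-- The affine chart `(x₂, …, xₘ) ↦ [1 : x₂ : ⋯ : xₘ]` of the projective space of `ℝ^E`, for the
order `e₁, …, eₘ` of the edges. -/
def chart (ε : G.EdgeOrder) : (Fin (Fintype.card G.E - 1) → ℝ) →ᵃ[ℝ] (G.E → ℝ) :=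
  (LinearMap.pi fun e =>
    if h : (ε.symm e : ℕ) = 0 then 0
    else LinearMap.proj (⟨(ε.symm e : ℕ) - 1, by have := (ε.symm e).2; omega⟩ :
      Fin (Fintype.card G.E - 1))).toAffineMap +
  AffineMap.const ℝ (Fin (Fintype.card G.E - 1) → ℝ)
    (fun e : G.E => if (ε.symm e : ℕ) = 0 then (1 : ℝ) else 0)

/-- The open simplex `{[x₁ : ⋯ : xₘ] | all xₑ > 0}` in the chart `x₁ = 1`; it is empty if the graph
has no edges. -/
def simplex (G : HGraph) : Set (Fin (Fintype.card G.E - 1) → ℝ) :=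
  {y | 0 < Fintype.card G.E ∧ ∀ i, 0 < y i}

/-- The coefficient of `dx₂ ∧ ⋯ ∧ dxₘ` (a positively oriented frame of the simplex) in the form
`φ_G`, in the chart `x₁ = 1`. It is zero if the degree of `φ_G` is not `m - 1`. -/
def integrand (ε : G.EdgeOrder) (t : G.Direction) (C : G.CycleBasis) :
    (Fin (Fintype.card G.E - 1) → ℝ) → ℝ :=
  fun y => topCoeff _ ((graphForm t C).pullback (chart ε) y)

/-- The normalised integral `(-2π)^{-ℓ/2} ∫ φ_G` over the open simplex, where the order of the
edges fixes the orientation of the simplex and the cycle basis fixes the sign of `φ_G` (which is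
zero for odd `ℓ`). -/
def pfIntegral (ε : G.EdgeOrder) (t : G.Direction) (C : G.CycleBasis) : ℝ :=
  ((-2 * Real.pi) ^ (G.loops / 2))⁻¹ *
    ∫ y in G.simplex, integrand ε t C y

/-- Generators of both sides of
`det ℤ^V ⊗ ⨂ₑ det ℤ^{H(e)} ≅ det ℤ^E ⊗ det H₁(G)`, i.e. a vertex order with edge directions, an
edge order, and a cycle basis, together with chains `P_k` with boundary `v_k - v₁`. -/
structure Presentation (G : HGraph) where
  frame : G.Frame
  edges : G.EdgeOrder
  cycles : G.CycleBasis
  path : Fin (Fintype.card G.V) → G.H → ℤ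
  path_mem : ∀ k, path k ∈ G.C1
  boundary_path : ∀ k k₁ : Fin (Fintype.card G.V), (k₁ : ℕ) = 0 →
    G.boundary (path k) =
      Pi.single (frame.order k) 1 - Pi.single (frame.order k₁) 1

namespace Presentation

/-- The matrix `A = (C₁ ⋯ C_ℓ P₂ ⋯ Pₙ)` with rows indexed by `e₁, …, eₘ` (for connected graphs,
`ℓ + n - 1 = m`). -/
def matrixA (p : Presentation G) :
    Matrix (Fin (Fintype.card G.E)) (Fin (Fintype.card G.E)) ℤ :=
  Matrix.of fun i j =>
    if h : (j : ℕ) < G.loops then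
      (p.cycles ⟨j, h⟩ : G.H → ℤ) (p.frame.dir.tail (p.edges i))
    else if h' : (j : ℕ) - G.loops + 1 < Fintype.card G.V then
      p.path ⟨(j : ℕ) - G.loops + 1, h'⟩ (p.frame.dir.tail (p.edges i))
    else 0

/-- The coefficient `± 1` of the orientation `o` with respect to the generator
`e₁ ∧ ⋯ ∧ eₘ ⊗ C₁ ∧ ⋯ ∧ C_ℓ` of `det ℤ^E ⊗ det H₁(G)`. -/
def sign (p : Presentation G) (o : Orientation G) : ℤ := (o.coeff p.frame : ℤ) * p.matrixA.det

/-- The canonical integral computed from `p`. If `p.sign o = 1`, it is `(-2π)^{-ℓ/2} ∫ φ_G`. -/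
def value (p : Presentation G) (o : Orientation G) : ℝ :=
  (p.sign o : ℝ) * pfIntegral p.edges p.frame.dir p.cycles

end Presentation

open Classical in
/-- The canonical integral `I_{(G,o)}(1)` of a connected oriented graph, computed with any
orders, directions, cycle basis and paths. -/
def canonicalIntegral (G : HGraph) (o : Orientation G) : ℝ :=
  if h : Nonempty (Presentation G) then (Classical.choice h).value o else 0

/-! ### Dipoles -/

/-- The `m`-fold multiedge: vertices `0, 1`; the edge `e` has the half-edges `(e, 0)` at vertex `0`
and `(e, 1)` at vertex `1`. -/
def dipole (m : ℕ) : HGraph where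
  V := Fin 2
  E := Fin m
  H := Fin m × Fin 2
  vert := Prod.snd
  edge := Prod.fst
  flip h := (h.1, h.2.rev)
  flip_flip h := by simp
  flip_ne h := by
    rcases h with ⟨e, s⟩
    fin_cases s <;> simp
  edge_surj e := ⟨(e, 0), rfl⟩
  edge_eq_iff h h' := by
    rcases h with ⟨e, s⟩
    rcases h' with ⟨e', s'⟩
    fin_cases s <;> fin_cases s' <;> simp [eq_comm]

/-- Vertex order `0 < 1`, all edges directed from `0` to `1`. -/
def dipoleFrame (m : ℕ) : (dipole m).Frame where
  order := finCongr (Fintype.card_fin 2)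
  dir := ⟨fun e => (e, 0), fun _ => rfl⟩

theorem dipole_connected (m : ℕ) (hm : 0 < m) : (dipole m).Connected := by
  refine ⟨⟨(0 : Fin 2)⟩, fun u v => ?_⟩
  by_cases h : u = v
  · subst h; exact Relation.ReflTransGen.refl
  · have key : ∀ a b : Fin 2, ¬ a = b → Fin.rev a = b := by decide
    exact Relation.ReflTransGen.single ⟨((⟨0, hm⟩ : Fin m), u), rfl, key u v h⟩

theorem dipole_valence (m : ℕ) (v : (dipole m).V) : (dipole m).valence v = m := by
  refine Eq.trans (Fintype.card_congr (β := Fin m) ?_) (Fintype.card_fin m)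
  exact
    { toFun := fun h => h.1.1
      invFun := fun e => ⟨(e, v), rfl⟩
      left_inv := by rintro ⟨⟨e, s⟩, h⟩; exact Subtype.ext (Prod.ext rfl h.symm)
      right_inv := fun e => rfl }

end HGraph

/-! ### The odd commutative graph complex as a bigraded vector space -/

/-- An oriented graph `(G, o)`. -/
structure OrGraph where
  graph : HGraph
  orient : HGraph.Orientation graph

namespace OrGraph

instance : Neg OrGraph := ⟨fun X => ⟨X.graph, -X.orient⟩⟩

/-- `X` and `Y` are isomorphic as oriented graphs. -/
def IsoTo (X Y : OrGraph) : Prop :=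
  ∃ φ : HGraph.Iso X.graph Y.graph, φ.MapsOrientation X.orient Y.orient

/-- Connected, with at least three half-edges at every vertex. -/
def IsGenerator (X : OrGraph) : Prop :=
  X.graph.Connected ∧ ∀ v, 3 ≤ X.graph.valence v

/-- The canonical integral `I_{(G,o)}(1)` of the bare Pfaffian form. -/
def integral (X : OrGraph) : ℝ := X.graph.canonicalIntegral X.orient

/-- The oriented dipole `D_m`. -/
def dipole (m : ℕ) : OrGraph := ⟨HGraph.dipole m, (HGraph.dipoleFrame m).orientation⟩

end OrGraph

/-- The generating oriented graphs of the graph complex. -/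
abbrev Generator : Type 1 := {X : OrGraph // X.IsGenerator}

namespace Generator

instance : Neg Generator := ⟨fun X => ⟨-X.1, X.2⟩⟩

/-- `D_{2i+3}`, `i ≥ 0`. -/
def oddDipole (i : ℕ) : Generator :=
  ⟨OrGraph.dipole (2 * i + 3), HGraph.dipole_connected _ (by omega), fun v =>
    le_of_le_of_eq (by omega) (HGraph.dipole_valence (2 * i + 3) v).symm⟩

/-- Loop number and degree. -/
def bidegree (X : Generator) : ℕ × ℤ := (X.1.graph.loops, X.1.graph.degree)

end Generator

/-- The relations `(G,o) ∼ (G', φ_* o)` and `(G,o) ∼ -(G,-o)`. -/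
def relations : Submodule ℚ (Generator →₀ ℚ) :=
  Submodule.span ℚ
    ({x | ∃ X Y : Generator, X.1.IsoTo Y.1 ∧ x = Finsupp.single X 1 - Finsupp.single Y 1} ∪
     {x | ∃ X : Generator, x = Finsupp.single X 1 + Finsupp.single (-X) 1})

/-- The vector space underlying the odd commutative graph complex. -/
def GC : Type 1 := (Generator →₀ ℚ) ⧸ relations

instance : AddCommGroup GC := inferInstanceAs (AddCommGroup ((Generator →₀ ℚ) ⧸ relations))

instance : Module ℚ GC := inferInstanceAs (Module ℚ ((Generator →₀ ℚ) ⧸ relations))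

/-- The quotient map from formal linear combinations of oriented graphs. -/
def GC.mk : (Generator →₀ ℚ) →ₗ[ℚ] GC := relations.mkQ

/-- The class of an oriented graph in the graph complex. -/
def cls (X : Generator) : GC := GC.mk (Finsupp.single X 1)

theorem GC.mk_eq_zero {x : Generator →₀ ℚ} (h : x ∈ relations) : GC.mk x = 0 :=
  (Submodule.Quotient.mk_eq_zero relations).2 h

/-- A function of oriented graphs that respects the relations extends linearly to the graph
complex. -/
def GC.lift {M : Type*} [AddCommGroup M] [Module ℚ M] (f : Generator → M)
    (h1 : ∀ X Y : Generator, X.1.IsoTo Y.1 → f X = f Y) (h2 : ∀ X : Generator, f (-X) = -f X) :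
    GC →ₗ[ℚ] M :=
  relations.liftQ (Finsupp.linearCombination ℚ f) (by
    unfold relations
    refine Submodule.span_le.2 ?_
    rintro x (⟨X, Y, h, rfl⟩ | ⟨X, rfl⟩)
    · simp [h1 X Y h]
    · simp [h2])

theorem GC.lift_cls {M : Type*} [AddCommGroup M] [Module ℚ M] (f : Generator → M) (h1 h2)
    (X : Generator) : GC.lift f h1 h2 (cls X) = f X := by
  have h : GC.lift f h1 h2 (cls X) = Finsupp.linearCombination ℚ f (Finsupp.single X 1) := rfl
  rw [h]; simp

theorem GC.hom_ext {M : Type*} [AddCommGroup M] [Module ℚ M] {f g : GC →ₗ[ℚ] M}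
    (h : ∀ Y, f (cls Y) = g (cls Y)) : f = g := by
  have hk : f.comp GC.mk = g.comp GC.mk :=
    Finsupp.lhom_ext' fun Y => LinearMap.ext_ring (h Y)
  ext x
  obtain ⟨y, rfl⟩ := Submodule.mkQ_surjective relations x
  exact LinearMap.congr_fun hk y

theorem cls_eq_of_iso {X Y : Generator} (h : X.1.IsoTo Y.1) : cls X = cls Y := by
  rw [← sub_eq_zero, cls, cls, ← map_sub]
  exact GC.mk_eq_zero (Submodule.subset_span (Or.inl ⟨X, Y, h, rfl⟩))

theorem cls_neg (X : Generator) : cls (-X) = -cls X := by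
  rw [eq_neg_iff_add_eq_zero, add_comm, cls, cls, ← map_add]
  exact GC.mk_eq_zero (Submodule.subset_span (Or.inr ⟨X, rfl⟩))

open Classical in
/-- The pairing of oriented graphs: `|Aut G|` if `G ∼ G'` and `G ≁ 0`, `-|Aut G|` if `G ∼ -G'` and
`G ≁ 0`, and zero otherwise. -/
def graphPairing (X Y : Generator) : ℚ :=
  if cls X = cls Y ∧ cls X ≠ 0 then X.1.graph.autCard
  else if cls X = -cls Y ∧ cls X ≠ 0 then -X.1.graph.autCard
  else 0

theorem eq_zero_of_eq_neg {a : GC} (h : a = -a) : a = 0 := by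
  have h2 : (2 : ℚ) • a = 0 := by
    rw [two_smul]; nth_rewrite 1 [h]; simp
  exact (smul_eq_zero.1 h2).resolve_left (by norm_num)

theorem graphPairing_neg_right (X Y : Generator) :
    graphPairing X (-Y) = -graphPairing X Y := by
  unfold graphPairing
  rw [cls_neg, neg_neg]
  by_cases h0 : cls X = 0
  · rw [if_neg (fun h => h.2 h0), if_neg (fun h => h.2 h0), if_neg (fun h => h.2 h0),
      if_neg (fun h => h.2 h0), neg_zero]
  by_cases h1 : cls X = cls Y
  · have h2 : ¬ cls X = -cls Y := fun h => h0 (eq_zero_of_eq_neg (h.trans (by rw [h1])))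
    rw [if_neg (fun h => h2 h.1), if_pos ⟨h1, h0⟩, if_pos ⟨h1, h0⟩]
  · by_cases h2 : cls X = -cls Y
    · rw [if_pos ⟨h2, h0⟩, if_neg (fun h => h1 h.1), if_pos ⟨h2, h0⟩, neg_neg]
    · rw [if_neg (fun h => h2 h.1), if_neg (fun h => h1 h.1), if_neg (fun h => h1 h.1),
        if_neg (fun h => h2 h.1), neg_zero]

theorem graphPairing_neg_left (X Y : Generator) :
    graphPairing (-X) Y = -graphPairing X Y := by
  rw [← graphPairing_neg_right]
  have e1 : (cls (-X) = cls Y) = (cls X = cls (-Y)) := by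
    rw [cls_neg, cls_neg]; exact propext neg_eq_iff_eq_neg
  have e2 : (cls (-X) = -cls Y) = (cls X = -cls (-Y)) := by
    rw [cls_neg, cls_neg, neg_neg]; exact propext neg_inj
  have e3 : (cls (-X) ≠ 0) = (cls X ≠ 0) := by
    rw [cls_neg]; exact propext neg_ne_zero
  have e4 : (-X).1.graph.autCard = X.1.graph.autCard := rfl
  unfold graphPairing
  rw [e4]
  classical
  exact if_congr (by rw [e1, e3]) rfl (if_congr (by rw [e2, e3]) rfl rfl)

theorem graphPairing_iso_left {X X' : Generator} (h : X.1.IsoTo X'.1) (Y : Generator) :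
    graphPairing X Y = graphPairing X' Y := by
  obtain ⟨φ, hφ⟩ := id h
  unfold graphPairing
  rw [cls_eq_of_iso h, HGraph.autCard_eq_of_iso φ]

theorem graphPairing_iso_right (X : Generator) {Y Y' : Generator} (h : Y.1.IsoTo Y'.1) :
    graphPairing X Y = graphPairing X Y' := by
  unfold graphPairing
  rw [cls_eq_of_iso h]

/-- The linear functional `⟨X, ·⟩`. -/
def pairingRight (X : Generator) : GC →ₗ[ℚ] ℚ :=
  GC.lift (graphPairing X) (fun _ _ h => graphPairing_iso_right X h) (graphPairing_neg_right X)

/-- The bilinear extension of `graphPairing`. -/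
def pairing : GC →ₗ[ℚ] GC →ₗ[ℚ] ℚ :=
  GC.lift pairingRight
    (fun X X' h => GC.hom_ext fun Y => by
      simp only [pairingRight, GC.lift_cls, graphPairing_iso_left h Y])
    (fun X => GC.hom_ext fun Y => by
      simp only [pairingRight, GC.lift_cls, LinearMap.neg_apply, graphPairing_neg_left X Y])

/-- The piece of loop number `p.1` and degree `p.2`. -/
def gr (p : ℕ × ℤ) : Submodule ℚ GC :=
  Submodule.span ℚ {x | ∃ X : Generator, X.bidegree = p ∧ x = cls X}

/-- The space of cochains, the degree completion `∏ gr_{ℓ,k}` of the graph complex. -/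
abbrev Cochain : Type 1 := ∀ p : ℕ × ℤ, gr p

/-- An oriented graph as a cochain, concentrated in its bidegree. -/
def Generator.cochain (X : Generator) : Cochain :=
  Pi.single X.bidegree ⟨cls X, Submodule.subset_span ⟨X, rfl, rfl⟩⟩

/-- The pairing of a cochain with a chain. Only finitely many bidegrees contribute, since pieces of
different bidegree are orthogonal and a chain has components in finitely many bidegrees. -/
def cochainPairing (Q : Cochain) (x : GC) : ℚ := ∑ᶠ p, pairing (Q p : GC) x

/-- The dipole sum `∑_{i ≥ 1} D_{2i+1} / (2 · (2i+1)!)` (here with `i + 1` in place of `i`). Each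
component of this infinite sum is a finite sum, since the dipoles have different bidegrees. -/
def MCdip : Cochain := fun p =>
  ∑ᶠ i : ℕ, (1 / (2 * (Nat.factorial (2 * i + 3) : ℚ))) • (Generator.oddDipole i).cochain p

end OddGC

end

noncomputable section

namespace OddGC

/-! ### The Pfaffian of a matrix of quadratic forms in degree one elements -/

/-! The Pfaffian of an ℓ × ℓ matrix of 2-forms has degree ℓ, while the simplex has dimension m - 1.
So the integrand vanishes unless ℓ is even and ℓ = m - 1, that is, unless the boundary map has rank
one; a connected graph then has exactly two vertices. In this case the cycle lattice is the kernel
of a single incidence row b with entries 0, ±1 (`exists_detecting_vertex`).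

Let c be the cycle matrix, D = diag(x) and q = ∑ bₑ²/xₑ. The vector D⁻¹b is D-orthogonal to the
columns of c. A Gram determinant gives det Λ = q ∏ xₑ (`det_laplacian`), and the two orthogonal
projections add up to the identity, so that cΛ⁻¹cᵀ = D⁻¹ - q⁻¹ (D⁻¹b)(D⁻¹b)ᵀ (used off the diagonal
in `green_eq`). The entries of dΛ Λ⁻¹ dΛ are ∑ c_{ai} (cΛ⁻¹cᵀ)_{ab} c_{bj} dx_a ∧ dx_b, and
monomials with a repeated dx_a vanish. Hence the Pfaffian only sees the rank one part, and all ℓ!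
terms of `topCoeff_pfaffian` agree. With A the unimodular matrix of the cycles and one more chain,
the integrand is det A ∏ bₑ times a fixed function, whose integral is a quotient of Gamma values
(`integral_dipole`) and is normalised to 1 (`dipole_constant`). So the integral is det A ∏ bₑ
(`pfIntegral_corank_one`).

In the canonical integral of a connected graph the orientation contributes a second factor det A =
±1. What remains is the orientation coefficient times ∏ bₑ, the combinatorial number `dipoleSign`.
It is independent of the frame because m is odd, and nonzero exactly for odd dipoles. Pairing with
an odd dipole D_m gives |Aut D_m| = 2 · m! times the same number on graphs with m edges; the
coefficients of the dipole sum cancel this factor. -/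

theorem topCoeff_prod_ι_of_ne {k l : ℕ} (h : l ≠ k) (α : Fin l → Module.Dual ℝ (Fin k → ℝ)) :
    topCoeff k (List.ofFn fun j => ExteriorAlgebra.ι ℝ (α j)).prod = 0 := by
  rw [← ExteriorAlgebra.ιMulti_apply, topCoeff, ExteriorAlgebra.liftAlternating_apply_ιMulti,
    Pi.single_eq_of_ne h]
  rfl

theorem topCoeff_prod_ι {k : ℕ} (α : Fin k → Module.Dual ℝ (Fin k → ℝ)) :
    topCoeff k (List.ofFn fun j => ExteriorAlgebra.ι ℝ (α j)).prod =
      (Matrix.of fun i j => α i (Pi.single j 1)).det := by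
  rw [← ExteriorAlgebra.ιMulti_apply, topCoeff, ExteriorAlgebra.liftAlternating_apply_ιMulti,
    Pi.single_eq_same]
  rfl

/-- The differential of a coordinate, in the exterior algebra. -/
def dy {k : ℕ} (a : Fin k) : ExteriorAlgebra ℝ (Module.Dual ℝ (Fin k → ℝ)) :=
  ExteriorAlgebra.ι ℝ (LinearMap.proj a)

theorem topCoeff_prod_dy {k : ℕ} (f : Fin k → Fin k) :
    topCoeff k (List.ofFn fun j => dy (f j)).prod =
      ((1 : Matrix (Fin k) (Fin k) ℝ).submatrix f id).det := by
  unfold dy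
  rw [topCoeff_prod_ι]
  congr 1
  ext i j
  simp [Matrix.one_apply, Pi.single_apply]

theorem det_one_submatrix_perm {k : ℕ} (σ : Equiv.Perm (Fin k)) :
    ((1 : Matrix (Fin k) (Fin k) ℝ).submatrix σ id).det = ((Equiv.Perm.sign σ : ℤˣ) : ℤ) := by
  rw [Matrix.det_permute]; simp

theorem topCoeff_prod_dy_of_not_injective {k : ℕ} {f : Fin k → Fin k}
    (hf : ¬ Function.Injective f) : topCoeff k (List.ofFn fun j => dy (f j)).prod = 0 := by
  rw [topCoeff_prod_dy]
  simp only [Function.Injective, not_forall] at hf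
  obtain ⟨i, j, hij, hne⟩ := hf
  exact Matrix.det_zero_of_row_eq hne (by
    funext a
    change (1 : Matrix (Fin k) (Fin k) ℝ) (f i) a = (1 : Matrix (Fin k) (Fin k) ℝ) (f j) a
    rw [hij])

theorem pfaffian_of_even {R : Type*} [Ring R] [Algebra ℝ R] {l n : ℕ} (h : l = 2 * n)
    (M : Matrix (Fin l) (Fin l) R) :
    pfaffian M = ((2 : ℝ) ^ n * (Nat.factorial n : ℝ))⁻¹ •
      ∑ π : Equiv.Perm (Fin l), ((Equiv.Perm.sign π : ℤˣ) : ℤ) •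
        (List.ofFn fun i : Fin n =>
          M (π ⟨2 * (i : ℕ), by have := i.2; omega⟩)
            (π ⟨2 * (i : ℕ) + 1, by have := i.2; omega⟩)).prod := by
  obtain rfl : n = l / 2 := by omega
  rw [pfaffian, if_pos ⟨l / 2, by omega⟩]

theorem pfaffian_of_odd {R : Type*} [Ring R] [Algebra ℝ R] {l : ℕ} (h : ¬ Even l)
    (M : Matrix (Fin l) (Fin l) R) : pfaffian M = 0 := if_neg h

/-- Pullback of forms acts by algebra homomorphisms of exterior algebras, so this reduces the
pullback of the Pfaffian form to the pullback of matrix entries. -/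
theorem map_pfaffian {R S : Type*} [Ring R] [Algebra ℝ R] [Ring S] [Algebra ℝ S] (f : R →ₐ[ℝ] S)
    {l : ℕ} (M : Matrix (Fin l) (Fin l) R) : f (pfaffian M) = pfaffian (M.map f) := by
  unfold pfaffian
  split_ifs
  · simp only [map_smul, map_sum, map_zsmul, map_list_prod, List.map_ofFn, Matrix.map_apply]
    rfl
  · exact map_zero f

/-- A product of pairs as a product of twice the length. -/
theorem prod_ofFn_pairs {R : Type*} [Monoid R] {n : ℕ} (g : Fin (n * 2) → R) :
    (List.ofFn fun i : Fin n => g (finProdFinEquiv (i, 0)) * g (finProdFinEquiv (i, 1))).prod =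
      (List.ofFn g).prod := by
  rw [List.ofFn_mul, List.prod_flatten, List.map_ofFn]
  congr 2
  funext i
  simp only [Function.comp_apply, List.ofFn_succ, List.ofFn_zero, List.prod_cons, List.prod_nil,
    mul_one]
  congr 2 <;> ext <;> simp [finProdFinEquiv, mul_comm, add_comm]

/-- The matrix with entries `∑ c_{ai} g_{ab} c_{bj} dy_a ∧ dy_b`. -/
def quadraticMatrix {k l : ℕ} (c : Matrix (Fin k) (Fin l) ℝ) (g : Matrix (Fin k) (Fin k) ℝ) :
    Matrix (Fin l) (Fin l) (ExteriorAlgebra ℝ (Module.Dual ℝ (Fin k → ℝ))) :=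
  Matrix.of fun i j => ∑ r : Fin k × Fin k, (c r.1 i * g r.1 r.2 * c r.2 j) • (dy r.1 * dy r.2)

theorem prod_quadraticMatrix {k n : ℕ} (c : Matrix (Fin k) (Fin (n * 2)) ℝ)
    (g : Matrix (Fin k) (Fin k) ℝ) (π : Fin (n * 2) → Fin (n * 2)) :
    (List.ofFn fun i : Fin n => quadraticMatrix c g (π (finProdFinEquiv (i, 0)))
        (π (finProdFinEquiv (i, 1)))).prod =
      ∑ f : Fin (n * 2) → Fin k, ((∏ j, c (f j) (π j)) *
        ∏ i : Fin n, g (f (finProdFinEquiv (i, 0))) (f (finProdFinEquiv (i, 1)))) •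
          (List.ofFn fun j => dy (f j)).prod := by
  rw [← MultilinearMap.mkPiAlgebraFin_apply (R := ℝ)]
  simp only [quadraticMatrix, Matrix.of_apply]
  rw [MultilinearMap.map_sum]
  -- Choosing an index pair in each of the n factors is the same as labelling all 2n positions.
  let E : (Fin (n * 2) → Fin k) ≃ (Fin n → Fin k × Fin k) :=
    ((Equiv.arrowCongr finProdFinEquiv.symm (Equiv.refl _)).trans
      (Equiv.curry (Fin n) (Fin 2) (Fin k))).trans
        (Equiv.arrowCongr (Equiv.refl _) (finTwoArrowEquiv (Fin k)))
  have hE : ∀ f i, E f i = (f (finProdFinEquiv (i, 0)), f (finProdFinEquiv (i, 1))) :=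
    fun f i => rfl
  rw [← E.sum_comp]
  refine Finset.sum_congr rfl fun f _ => ?_
  simp only [hE]
  rw [MultilinearMap.map_smul_univ, MultilinearMap.mkPiAlgebraFin_apply,
    prod_ofFn_pairs (fun j => dy (f j)), ← Equiv.prod_comp finProdFinEquiv, Fintype.prod_prod_type,
    ← Finset.prod_mul_distrib]
  congr 1
  refine Finset.prod_congr rfl fun i _ => ?_
  rw [Fin.prod_univ_two]
  ring

theorem pfaffian_quadraticMatrix {k n : ℕ} (c : Matrix (Fin k) (Fin (n * 2)) ℝ)
    (g : Matrix (Fin k) (Fin k) ℝ) :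
    pfaffian (quadraticMatrix c g) = ((2 : ℝ) ^ n * (Nat.factorial n : ℝ))⁻¹ •
      ∑ π : Equiv.Perm (Fin (n * 2)), ∑ f : Fin (n * 2) → Fin k,
        ((((Equiv.Perm.sign π : ℤˣ) : ℤ) : ℝ) * ((∏ j, c (f j) (π j)) *
        ∏ i : Fin n, g (f (finProdFinEquiv (i, 0))) (f (finProdFinEquiv (i, 1))))) •
          (List.ofFn fun j => dy (f j)).prod := by
  rw [pfaffian_of_even (mul_comm n 2)]
  congr 1
  refine Finset.sum_congr rfl fun π _ => ?_
  have h := prod_quadraticMatrix c g π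
  have e0 : ∀ i : Fin n, (finProdFinEquiv (i, (0 : Fin 2)) : Fin (n * 2)) =
      ⟨2 * (i : ℕ), by have := i.2; omega⟩ := fun i => by ext; simp [finProdFinEquiv]
  have e1 : ∀ i : Fin n, (finProdFinEquiv (i, (1 : Fin 2)) : Fin (n * 2)) =
      ⟨2 * (i : ℕ) + 1, by have := i.2; omega⟩ := fun i => by
    ext; simp [finProdFinEquiv, add_comm]
  simp only [← e0, ← e1, h]
  simp only [Finset.smul_sum, ← Int.cast_smul_eq_zsmul ℝ, smul_smul]

/-- Every monomial in the expansion has degree l, and for odd l the Pfaffian is zero by convention.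
-/
theorem topCoeff_pfaffian_of_ne {k l : ℕ} (h : l ≠ k) (c : Matrix (Fin k) (Fin l) ℝ)
    (g : Matrix (Fin k) (Fin k) ℝ) : topCoeff k (pfaffian (quadraticMatrix c g)) = 0 := by
  by_cases hl : Even l
  · obtain ⟨n, rfl⟩ : ∃ n, l = n * 2 := ⟨l / 2, by have := Nat.even_iff.1 hl; omega⟩
    rw [pfaffian_quadraticMatrix]
    simp only [map_smul, map_sum, dy, topCoeff_prod_ι_of_ne h, smul_zero, Finset.sum_const_zero]
  · rw [pfaffian_of_odd hl, map_zero]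

/-- For a fixed labelling f of the positions, the signed sum over π is the determinant of the rows f
of c. Only permutations f = σ survive in top degree. Reordering the rows and reordering the dy's
each give sgn σ, so the signs cancel and an unsigned sum over σ remains. -/
theorem topCoeff_pfaffian {n : ℕ} (c g : Matrix (Fin (n * 2)) (Fin (n * 2)) ℝ) :
    topCoeff (n * 2) (pfaffian (quadraticMatrix c g)) =
      ((2 : ℝ) ^ n * (Nat.factorial n : ℝ))⁻¹ * (c.det *
        ∑ σ : Equiv.Perm (Fin (n * 2)),
          ∏ i : Fin n, g (σ (finProdFinEquiv (i, 0))) (σ (finProdFinEquiv (i, 1)))) := by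
  rw [pfaffian_quadraticMatrix, map_smul, smul_eq_mul, Finset.sum_comm, map_sum]
  congr 1
  have key : ∀ f : Fin (n * 2) → Fin (n * 2),
      topCoeff (n * 2) (∑ π : Equiv.Perm (Fin (n * 2)),
        ((((Equiv.Perm.sign π : ℤˣ) : ℤ) : ℝ) * ((∏ j, c (f j) (π j)) *
        ∏ i : Fin n, g (f (finProdFinEquiv (i, 0))) (f (finProdFinEquiv (i, 1))))) •
          (List.ofFn fun j => dy (f j)).prod) =
      (c.submatrix f id).det *
        (∏ i : Fin n, g (f (finProdFinEquiv (i, 0))) (f (finProdFinEquiv (i, 1)))) *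
        topCoeff (n * 2) (List.ofFn fun j => dy (f j)).prod := by
    intro f
    rw [← Finset.sum_smul (R := ℝ), map_smul, smul_eq_mul, ← Matrix.det_transpose, Matrix.det_apply']
    congr 1
    rw [Finset.sum_mul]
    refine Finset.sum_congr rfl fun π _ => ?_
    simp only [Matrix.transpose_apply, Matrix.submatrix_apply, id]
    ring
  simp only [key]
  rw [Finset.mul_sum]
  symm
  refine Finset.sum_of_injOn (fun σ : Equiv.Perm (Fin (n * 2)) => (σ : Fin (n * 2) → Fin (n * 2)))
    (fun _ _ _ _ h => DFunLike.coe_injective h) (fun _ _ => Finset.mem_coe.2 (Finset.mem_univ _))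
    ?_ ?_
  · intro f _ hf
    rw [topCoeff_prod_dy_of_not_injective, mul_zero]
    intro hinj
    exact hf ⟨Equiv.ofBijective f (Finite.injective_iff_bijective.1 hinj), by simp, rfl⟩
  · intro σ _
    rw [Matrix.det_permute, topCoeff_prod_dy, det_one_submatrix_perm]
    rcases Int.units_eq_one_or (Equiv.Perm.sign σ) with h | h <;> simp [h]

end OddGC

namespace OddGC

/-! ### The Laplacian of a corank one lattice -/

section Corank

open Matrix

variable {k : ℕ} (c : Matrix (Fin (k + 1)) (Fin k) ℝ) (b x P : Fin (k + 1) → ℝ)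

/-- The matrix `c` with the additional last column `P`. -/
def appendCol : Matrix (Fin (k + 1)) (Fin (k + 1)) ℝ := Matrix.of fun i => Fin.snoc (c i) (P i)

/-- The quadratic form `∑ bₑ² / xₑ`. -/
def invForm : ℝ := ∑ e, b e ^ 2 / x e

variable {c b x P}

theorem vecMul_appendCol (hb : b ᵥ* c = 0) (hP : b ⬝ᵥ P = 1) :
    b ᵥ* appendCol c P = Pi.single (Fin.last k) 1 := by
  ext j
  refine Fin.lastCases ?_ (fun j => ?_) j
  · rw [Pi.single_eq_same, ← hP]
    simp [Matrix.vecMul, dotProduct, appendCol]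
  · rw [Pi.single_eq_of_ne (Fin.castSucc_lt_last j).ne]
    refine Eq.trans ?_ (congrFun hb j)
    simp [Matrix.vecMul, dotProduct, appendCol]

theorem updateCol_appendCol (v : Fin (k + 1) → ℝ) :
    (appendCol c P).updateCol (Fin.last k) v = appendCol c v := by
  ext i j
  refine Fin.lastCases ?_ (fun j => ?_) j
  · simp [appendCol]
  · rw [Matrix.updateCol_ne (Fin.castSucc_lt_last j).ne]; simp [appendCol]

/-- The determinant is a linear form in the last column that vanishes on the columns of c, hence a
multiple of b, normalised at P. The proof reads this off from Cramer's rule, since bᵀ(c | P) is the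
last unit row. -/
theorem det_appendCol (hb : b ᵥ* c = 0) (hP : b ⬝ᵥ P = 1) (v : Fin (k + 1) → ℝ) :
    (appendCol c v).det = (b ⬝ᵥ v) * (appendCol c P).det := by
  rw [← updateCol_appendCol (P := P), ← Matrix.cramer_apply]
  have h : b ⬝ᵥ (appendCol c P *ᵥ (appendCol c P).cramer v) =
      b ⬝ᵥ ((appendCol c P).det • v) := by rw [Matrix.mulVec_cramer]
  rw [Matrix.dotProduct_mulVec, vecMul_appendCol hb hP, single_one_dotProduct,
    dotProduct_smul] at h
  rw [h, smul_eq_mul, mul_comm]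

/-- Since bᵀ(c | P) is the last unit row, the last row of the adjugate of (c | P) is det(c | P) · b.
Its first entry is the minor in question, with the sign (-1)^k = 1. -/
theorem det_submatrix_succ (hb : b ᵥ* c = 0) (hP : b ⬝ᵥ P = 1) (hk : Even k) :
    (c.submatrix Fin.succ id).det = (appendCol c P).det * b 0 := by
  have h : (b ᵥ* appendCol c P) ᵥ* (appendCol c P).adjugate = (appendCol c P).det • b := by
    rw [Matrix.vecMul_vecMul, Matrix.mul_adjugate, Matrix.vecMul_smul, Matrix.vecMul_one]
  rw [vecMul_appendCol hb hP] at h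
  have h0 := congrFun h 0
  rw [Matrix.single_one_vecMul, Matrix.row_apply, Matrix.adjugate_fin_succ_eq_det_submatrix] at h0
  simp only [Fin.val_zero, Fin.val_last, zero_add, hk.neg_one_pow, one_mul, Pi.smul_apply,
    smul_eq_mul] at h0
  rw [← h0]
  congr 1
  ext i j
  simp [appendCol, Fin.succAbove_last]

/-- `bₑ / xₑ` as a column. -/
def invCol (b x : Fin (k + 1) → ℝ) : Matrix (Fin (k + 1)) (Fin 1) ℝ :=
  Matrix.of fun i _ => b i / x i

theorem fromCols_eq (v : Fin (k + 1) → ℝ) :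
    Matrix.fromCols c (Matrix.of fun i (_ : Fin 1) => v i) =
      (appendCol c v).submatrix id finSumFinEquiv := by
  ext i (j | j)
  · have : finSumFinEquiv (Sum.inl j : Fin k ⊕ Fin 1) = j.castSucc := rfl
    simp [appendCol, this]
  · have : finSumFinEquiv (Sum.inr j : Fin k ⊕ Fin 1) = Fin.last k := by
      obtain rfl : j = 0 := Subsingleton.elim _ _
      rfl
    simp [appendCol, this]

theorem invCol_diag (hx : ∀ e, 0 < x e) : diagonal x * invCol b x = Matrix.of fun i _ => b i := by
  ext i j
  rw [Matrix.diagonal_mul]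
  exact mul_div_cancel₀ _ (hx i).ne'

/-- For the inner product diag(x), the vector with entries bₑ/xₑ is orthogonal to the columns of c.
It completes them to a basis with block diagonal Gram matrix. -/
theorem cT_diag_invCol (hx : ∀ e, 0 < x e) (hb : b ᵥ* c = 0) : cᵀ * (diagonal x * invCol b x) = 0 := by
  rw [invCol_diag hx]
  ext i j
  refine Eq.trans ?_ (congrFun hb i)
  simp [Matrix.mul_apply, Matrix.vecMul, dotProduct, mul_comm]

theorem invColT_diag_c (hx : ∀ e, 0 < x e) (hb : b ᵥ* c = 0) : (invCol b x)ᵀ * (diagonal x * c) = 0 := by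
  have h := congrArg Matrix.transpose (cT_diag_invCol (c := c) hx hb)
  simpa [Matrix.transpose_mul, Matrix.mul_assoc] using h

theorem invColT_diag_invCol (hx : ∀ e, 0 < x e) :
    (invCol b x)ᵀ * (diagonal x * invCol b x) = Matrix.of fun _ _ => invForm b x := by
  rw [invCol_diag hx]
  ext i j
  simp only [Matrix.mul_apply, Matrix.transpose_apply, invCol, Matrix.of_apply, invForm]
  exact Finset.sum_congr rfl fun e _ => by ring

theorem invForm_pos (hx : ∀ e, 0 < x e) (hP : b ⬝ᵥ P = 1) : 0 < invForm b x := by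
  refine Finset.sum_pos' (fun e _ => div_nonneg (sq_nonneg _) (hx e).le) ?_
  by_contra! h
  have h0 : ∀ e, b e = 0 := fun e => by
    by_contra hne
    exact (h e (Finset.mem_univ e)).not_gt (div_pos (by positivity) (hx e))
  simp [dotProduct, h0] at hP

theorem dotProduct_invCol : (b ⬝ᵥ fun i => b i / x i) = invForm b x :=
  Finset.sum_congr rfl fun e _ => by ring

/-- The Gram matrix of (c | D⁻¹b) with respect to D = diag(x) has blocks Λ and q. Its determinant is
also det(c | D⁻¹b)² ∏ xₑ = q² ∏ xₑ, and one factor q cancels. -/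
theorem det_laplacian (hx : ∀ e, 0 < x e) (hb : b ᵥ* c = 0) (hP : b ⬝ᵥ P = 1)
    (hA : (appendCol c P).det ^ 2 = 1) :
    (cᵀ * diagonal x * c).det = invForm b x * ∏ e, x e := by
  have hq := invForm_pos hx hP
  have h1 : (fromCols c (invCol b x))ᵀ * (diagonal x * fromCols c (invCol b x)) =
      fromBlocks (cᵀ * diagonal x * c) 0 0 (Matrix.of fun _ _ => invForm b x) := by
    rw [transpose_fromCols, mul_fromCols, fromRows_mul_fromCols, cT_diag_invCol hx hb,
      invColT_diag_c hx hb, invColT_diag_invCol hx, Matrix.mul_assoc]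
  have h2 := congrArg Matrix.det h1
  have h3 : fromCols c (invCol b x) =
      (appendCol c fun i => b i / x i).submatrix id finSumFinEquiv := fromCols_eq _
  have h4 : ((appendCol c fun i => b i / x i).submatrix id finSumFinEquiv)ᵀ *
      (diagonal x * (appendCol c fun i => b i / x i).submatrix id finSumFinEquiv) =
      ((appendCol c fun i => b i / x i)ᵀ *
        (diagonal x * appendCol c fun i => b i / x i)).submatrix finSumFinEquiv
          finSumFinEquiv := rfl
  rw [det_fromBlocks_zero₁₂, det_fin_one, h3, h4, det_submatrix_equiv_self, det_mul, det_mul,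
    det_transpose, det_diagonal, det_appendCol hb hP, dotProduct_invCol] at h2
  have h5 : (cᵀ * diagonal x * c).det * invForm b x =
      (invForm b x * ∏ e, x e) * invForm b x := by
    refine h2.symm.trans ?_
    linear_combination invForm b x ^ 2 * (∏ e, x e) * hA
  exact mul_right_cancel₀ hq.ne' h5

/-- With D = diag(x), the matrix G of the proof makes GD the sum of the D-orthogonal projections to
the span of c and to D⁻¹b. So GD = 1, and the off-diagonal entries of G = D⁻¹ vanish. -/
theorem green_eq (hx : ∀ e, 0 < x e) (hb : b ᵥ* c = 0) (hP : b ⬝ᵥ P = 1)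
    (hA : (appendCol c P).det ^ 2 = 1) {i j : Fin (k + 1)} (hij : i ≠ j) :
    (c * (cᵀ * diagonal x * c)⁻¹ * cᵀ) i j = - (invForm b x)⁻¹ * ((b i / x i) * (b j / x j)) := by
  have hq := invForm_pos hx hP
  have hu : IsUnit (cᵀ * diagonal x * c).det := by
    rw [det_laplacian hx hb hP hA]
    exact (mul_pos hq (Finset.prod_pos fun e _ => hx e)).ne'.isUnit
  set G := c * (cᵀ * diagonal x * c)⁻¹ * cᵀ + (invForm b x)⁻¹ • (invCol b x * (invCol b x)ᵀ) with hG
  have h1 : (G * diagonal x) * fromCols c (invCol b x) = fromCols c (invCol b x) := by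
    rw [mul_fromCols]
    congr 1
    · rw [hG, Matrix.mul_assoc, Matrix.add_mul, Matrix.smul_mul, Matrix.mul_assoc (invCol b x),
        invColT_diag_c hx hb, Matrix.mul_zero, smul_zero, add_zero, Matrix.mul_assoc _ cᵀ,
        ← Matrix.mul_assoc cᵀ, Matrix.mul_assoc, Matrix.nonsing_inv_mul _ hu, Matrix.mul_one]
    · rw [hG, Matrix.mul_assoc, Matrix.add_mul, Matrix.smul_mul, Matrix.mul_assoc (invCol b x),
        invColT_diag_invCol hx, Matrix.mul_assoc _ cᵀ, cT_diag_invCol hx hb, Matrix.mul_zero,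
        zero_add]
      ext i j
      obtain rfl : j = 0 := Subsingleton.elim _ _
      simp [Matrix.mul_apply, hq.ne', mul_comm]
  have h3 : fromCols c (invCol b x) =
      (appendCol c fun i => b i / x i).submatrix id finSumFinEquiv := fromCols_eq _
  have h2 : (G * diagonal x) * (appendCol c fun i => b i / x i) =
      appendCol c fun i => b i / x i := by
    have h4 : ((G * diagonal x) * (appendCol c fun i => b i / x i)).submatrix id
        (finSumFinEquiv (m := k) (n := 1)) =
        (appendCol c fun i => b i / x i).submatrix id finSumFinEquiv := by
      rw [← h3, ← h1, h3]
      rfl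
    ext i j
    have h5 := congrFun (congrFun h4 i) (finSumFinEquiv.symm j)
    simpa using h5
  have hdet : IsUnit (appendCol c fun i => b i / x i).det := by
    rw [det_appendCol hb hP, dotProduct_invCol]
    refine (mul_ne_zero hq.ne' fun h => ?_).isUnit
    rw [h] at hA; norm_num at hA
  have h6 : G * diagonal x = 1 := by
    have := congrArg (· * (appendCol c fun i => b i / x i)⁻¹) h2
    simpa [Matrix.mul_assoc, Matrix.mul_nonsing_inv _ hdet] using this
  have h7 := congrFun (congrFun h6 i) j
  rw [Matrix.mul_diagonal, Matrix.one_apply_ne hij] at h7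
  have h8 := (mul_eq_zero.1 h7).resolve_right (hx j).ne'
  rw [hG, Matrix.add_apply, Matrix.smul_apply, Matrix.mul_apply (M := invCol b x)] at h8
  simp only [invCol, Matrix.of_apply, Matrix.transpose_apply, Finset.univ_unique,
    Finset.sum_singleton, smul_eq_mul] at h8
  linear_combination h8

/-- A permutation pairs only distinct indices, where the Green matrix has rank one form. Each
product is therefore independent of σ, and the sum over σ is (2n)! times one term. -/
theorem topCoeff_corank_one {n : ℕ} {c : Matrix (Fin (n * 2 + 1)) (Fin (n * 2)) ℝ}
    {b x P : Fin (n * 2 + 1) → ℝ} (hx : ∀ e, 0 < x e) (hb : b ᵥ* c = 0) (hP : b ⬝ᵥ P = 1)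
    (hA : (appendCol c P).det ^ 2 = 1) :
    topCoeff (n * 2) (pfaffian (quadraticMatrix (c.submatrix Fin.succ id)
      ((c * (cᵀ * Matrix.diagonal x * c)⁻¹ * cᵀ).submatrix Fin.succ Fin.succ))) =
    ((2 : ℝ) ^ n * (Nat.factorial n : ℝ))⁻¹ * (((appendCol c P).det * b 0) *
      ((Nat.factorial (n * 2) : ℝ) * ((-(invForm b x)⁻¹) ^ n *
        ∏ a : Fin (n * 2), b a.succ / x a.succ))) := by
  rw [topCoeff_pfaffian, det_submatrix_succ hb hP ⟨n, by ring⟩]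
  congr 2
  have h : ∀ σ : Equiv.Perm (Fin (n * 2)), ∏ i : Fin n,
      ((c * (cᵀ * Matrix.diagonal x * c)⁻¹ * cᵀ).submatrix Fin.succ Fin.succ)
        (σ (finProdFinEquiv (i, 0))) (σ (finProdFinEquiv (i, 1))) =
      (-(invForm b x)⁻¹) ^ n * ∏ a : Fin (n * 2), b a.succ / x a.succ := by
    intro σ
    rw [← Equiv.prod_comp σ, ← Equiv.prod_comp finProdFinEquiv, Fintype.prod_prod_type]
    have : (-(invForm b x)⁻¹) ^ n = ∏ i : Fin n, (-(invForm b x)⁻¹) := by simp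
    rw [this, ← Finset.prod_mul_distrib]
    refine Finset.prod_congr rfl fun i _ => ?_
    rw [Fin.prod_univ_two, Matrix.submatrix_apply, green_eq hx hb hP hA]
    simp
  simp only [h, Finset.sum_const, nsmul_eq_mul, Finset.card_univ, Fintype.card_perm,
    Fintype.card_fin]

end Corank

end OddGC

namespace OddGC

/-! ### The dipole integral -/

open MeasureTheory Set

/-- The substitution x ↦ 1/x turns this into the integral for Γ(1/2). -/
theorem integral_rpow_mul_exp_neg_div {t : ℝ} (ht : 0 < t) :
    ∫ x in Ioi (0 : ℝ), x ^ (-(3 / 2) : ℝ) * Real.exp (-(t * x⁻¹)) =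
      Real.sqrt Real.pi * t ^ (-(1 / 2) : ℝ) := by
  have h := integral_comp_rpow_Ioi
    (fun u : ℝ => u ^ ((1 / 2 : ℝ) - 1) * Real.exp (-(t * u))) (p := -1) (by norm_num)
  rw [Real.integral_rpow_mul_exp_neg_mul_Ioi (by norm_num) ht, Real.Gamma_one_half_eq] at h
  rw [one_div t, Real.inv_rpow ht.le, ← Real.rpow_neg ht.le, mul_comm] at h
  rw [← h]
  refine setIntegral_congr_fun measurableSet_Ioi fun x hx => ?_
  have hx : 0 < x := hx
  simp only [abs_neg, abs_one, one_mul, smul_eq_mul, Real.rpow_neg_one]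
  rw [Real.inv_rpow hx.le, ← Real.rpow_neg hx.le, ← mul_assoc, ← Real.rpow_add hx]
  norm_num

/-- The Gamma integrand whose `t`-integral is the dipole integrand. -/
def gammaKernel (k : ℕ) (y : Fin k → ℝ) (t : ℝ) : ℝ :=
  (t ^ (((k : ℝ) + 1) / 2 - 1) * Real.exp (-t)) *
    ∏ a, (y a ^ (-(3 / 2) : ℝ) * Real.exp (-(t * (y a)⁻¹)))

/-- The measure of the positive orthant. -/
def orthant (k : ℕ) : Measure (Fin k → ℝ) :=
  Measure.pi fun _ => (volume : Measure ℝ).restrict (Ioi 0)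

theorem restrict_orthant (k : ℕ) :
    (volume : Measure (Fin k → ℝ)).restrict {y | ∀ i, 0 < y i} = orthant k := by
  rw [orthant, ← Measure.restrict_pi_pi, volume_pi]
  congr 1
  ext y
  simp

instance (k : ℕ) : SigmaFinite (orthant k) := by unfold orthant; infer_instance

theorem measurableSet_orthant (k : ℕ) : MeasurableSet {y : Fin k → ℝ | ∀ i, 0 < y i} := by
  have h : {y : Fin k → ℝ | ∀ i, 0 < y i} = Set.pi univ fun _ => Ioi 0 := by ext y; simp
  rw [h]
  exact MeasurableSet.univ_pi fun _ => measurableSet_Ioi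

theorem ae_orthant (k : ℕ) : ∀ᵐ y ∂orthant k, ∀ i, 0 < y i := by
  rw [← restrict_orthant]
  exact ae_restrict_mem (measurableSet_orthant k)

/-- The y-integral factorises into k copies of √π t^(-1/2); the powers of t add up to (k+1)/2 - 1 -
k/2 = -1/2. -/
theorem integral_gammaKernel_left {k : ℕ} {t : ℝ} (ht : 0 < t) :
    ∫ y, gammaKernel k y t ∂orthant k =
      Real.sqrt Real.pi ^ k * (t ^ ((1 / 2 : ℝ) - 1) * Real.exp (-(1 * t))) := by
  unfold gammaKernel orthant
  rw [integral_const_mul, integral_fintype_prod_eq_prod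
    (f := fun (_ : Fin k) (x : ℝ) => x ^ (-(3 / 2) : ℝ) * Real.exp (-(t * x⁻¹)))]
  simp only [integral_rpow_mul_exp_neg_div ht, Finset.prod_const, Finset.card_univ,
    Fintype.card_fin]
  have : t ^ (((k : ℝ) + 1) / 2 - 1) * (t ^ (-(1 / 2) : ℝ)) ^ k = t ^ ((1 / 2 : ℝ) - 1) := by
    rw [← Real.rpow_natCast, ← Real.rpow_mul ht.le, ← Real.rpow_add ht]
    congr 1; ring
  rw [mul_pow, ← this, one_mul]
  ring

theorem integral_gammaKernel_right {k : ℕ} {y : Fin k → ℝ} (hy : ∀ a, 0 < y a) :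
    ∫ t in Ioi (0 : ℝ), gammaKernel k y t = Real.Gamma (((k : ℝ) + 1) / 2) *
      ((1 / (1 + ∑ a, (y a)⁻¹)) ^ (((k : ℝ) + 1) / 2) * ∏ a, y a ^ (-(3 / 2) : ℝ)) := by
  have hq : 0 < 1 + ∑ a, (y a)⁻¹ :=
    add_pos_of_pos_of_nonneg one_pos (Finset.sum_nonneg fun a _ => (inv_pos.2 (hy a)).le)
  have h : ∀ t, gammaKernel k y t = (t ^ (((k : ℝ) + 1) / 2 - 1) *
      Real.exp (-((1 + ∑ a, (y a)⁻¹) * t))) * ∏ a, y a ^ (-(3 / 2) : ℝ) := by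
    intro t
    have : Real.exp (-((1 + ∑ a, (y a)⁻¹) * t)) =
        Real.exp (-t) * ∏ a, Real.exp (-(t * (y a)⁻¹)) := by
      rw [← Real.exp_sum, ← Real.exp_add, Finset.sum_neg_distrib, ← Finset.mul_sum]
      congr 1; ring
    rw [gammaKernel, Finset.prod_mul_distrib, this]
    ring
  simp only [h]
  rw [integral_mul_const, Real.integral_rpow_mul_exp_neg_mul_Ioi (by positivity) hq]
  ring

/-- The kernel is non-negative, so it suffices that the iterated integral, first over y, is finite.
-/
theorem integrable_gammaKernel (k : ℕ) :
    Integrable (Function.uncurry (gammaKernel k))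
      ((orthant k).prod ((volume : Measure ℝ).restrict (Ioi 0))) := by
  have hm : Measurable (Function.uncurry (gammaKernel k)) := by
    unfold gammaKernel Function.uncurry
    fun_prop
  have hpos : ∀ t ∈ Ioi (0 : ℝ), ∀ y : Fin k → ℝ, (∀ i, 0 < y i) → 0 ≤ gammaKernel k y t := by
    intro t ht y hy
    have ht : 0 < t := ht
    exact mul_nonneg (by positivity) (Finset.prod_nonneg fun a _ =>
      mul_nonneg (Real.rpow_nonneg (hy a).le _) (Real.exp_pos _).le)
  rw [integrable_prod_iff' hm.aestronglyMeasurable]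
  constructor
  · filter_upwards [ae_restrict_mem measurableSet_Ioi] with t ht
    have ht : 0 < t := ht
    -- The integral of a non-integrable function is zero by convention, so a nonzero value certifies
    -- integrability.
    refine .of_integral_ne_zero ?_
    simp only [Function.uncurry]
    rw [integral_gammaKernel_left ht]
    positivity
  · have h1 : IntegrableOn (fun t : ℝ => Real.sqrt Real.pi ^ k *
        (t ^ ((1 / 2 : ℝ) - 1) * Real.exp (-(1 * t)))) (Ioi 0) := by
      refine Integrable.const_mul (.of_integral_ne_zero ?_) _
      rw [Real.integral_rpow_mul_exp_neg_mul_Ioi (by norm_num) one_pos, Real.Gamma_one_half_eq]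
      positivity
    refine h1.congr ?_
    filter_upwards [ae_restrict_mem measurableSet_Ioi] with t ht
    rw [← integral_gammaKernel_left ht]
    refine integral_congr_ae ?_
    filter_upwards [ae_orthant k] with y hy
    exact (Real.norm_of_nonneg (hpos t ht y hy)).symm

theorem integrable_dipole (k : ℕ) :
    Integrable (fun y : Fin k → ℝ => (1 / (1 + ∑ a, (y a)⁻¹)) ^ (((k : ℝ) + 1) / 2) *
      ∏ a, y a ^ (-(3 / 2) : ℝ)) (orthant k) := by
  have h := (integrable_gammaKernel k).integral_prod_left.const_mul
    (Real.Gamma (((k : ℝ) + 1) / 2))⁻¹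
  refine h.congr ?_
  filter_upwards [ae_orthant k] with y hy
  simp only [Function.uncurry]
  rw [integral_gammaKernel_right hy, inv_mul_cancel_left₀]
  exact (Real.Gamma_pos_of_pos (by positivity)).ne'

/-- Fubini for the Gamma kernel: integrating over t first gives Γ((k+1)/2) times the wanted
integral, integrating over y first gives √π^k · Γ(1/2). -/
theorem integral_dipole (k : ℕ) :
    ∫ y : Fin k → ℝ, (1 / (1 + ∑ a, (y a)⁻¹)) ^ (((k : ℝ) + 1) / 2) *
      ∏ a, y a ^ (-(3 / 2) : ℝ) ∂orthant k =
        Real.sqrt Real.pi ^ (k + 1) / Real.Gamma (((k : ℝ) + 1) / 2) := by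
  have hG := (Real.Gamma_pos_of_pos (s := ((k : ℝ) + 1) / 2) (by positivity)).ne'
  have h := integral_integral_swap (integrable_gammaKernel k)
  have h1 : ∫ t in Ioi (0 : ℝ), ∫ y, gammaKernel k y t ∂orthant k =
      Real.sqrt Real.pi ^ (k + 1) := by
    rw [setIntegral_congr_fun measurableSet_Ioi fun t ht => integral_gammaKernel_left ht,
      integral_const_mul, Real.integral_rpow_mul_exp_neg_mul_Ioi (by norm_num) one_pos,
      Real.Gamma_one_half_eq, pow_succ]
    simp
  rw [h1] at h
  rw [eq_div_iff hG, ← h, mul_comm, ← integral_const_mul]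
  refine integral_congr_ae ?_
  filter_upwards [ae_orthant k] with y hy
  rw [integral_gammaKernel_right hy]

/-- With q the first factor and p = ∏ yₐ, the root of det Λ gives q^(-1/2) p^(-1/2) and the Pfaffian
gives q^(-n) p⁻¹. -/
theorem dipole_integrand_eq {n : ℕ} {y : Fin (n * 2) → ℝ} (hy : ∀ a, 0 < y a) :
    (Real.sqrt ((1 + ∑ a, (y a)⁻¹) * ∏ a, y a))⁻¹ * ((1 + ∑ a, (y a)⁻¹)⁻¹ ^ n *
      ∏ a, (y a)⁻¹) = (1 / (1 + ∑ a, (y a)⁻¹)) ^ ((((n * 2 : ℕ) : ℝ) + 1) / 2) *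
      ∏ a, y a ^ (-(3 / 2) : ℝ) := by
  have hq : 0 < 1 + ∑ a, (y a)⁻¹ :=
    add_pos_of_pos_of_nonneg one_pos (Finset.sum_nonneg fun a _ => (inv_pos.2 (hy a)).le)
  have hp : 0 < ∏ a, y a := Finset.prod_pos fun a _ => hy a
  rw [Real.sqrt_mul hq.le, mul_inv, Finset.prod_inv_distrib, Real.finsetProd_rpow _ _
    (fun a _ => (hy a).le), one_div]
  generalize 1 + ∑ a, (y a)⁻¹ = q at hq
  generalize ∏ a, y a = p at hp
  have e1 : q⁻¹ ^ ((((n * 2 : ℕ) : ℝ) + 1) / 2) = (Real.sqrt q)⁻¹ * q⁻¹ ^ n := by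
    rw [← Real.sqrt_inv, Real.sqrt_eq_rpow, ← Real.rpow_natCast q⁻¹ n,
      ← Real.rpow_add (inv_pos.2 hq)]
    congr 1; push_cast; ring
  have e2 : p ^ (-(3 / 2) : ℝ) = (Real.sqrt p)⁻¹ * p⁻¹ := by
    rw [← Real.sqrt_inv, Real.sqrt_eq_rpow, Real.inv_rpow hp.le, ← Real.rpow_neg hp.le,
      ← Real.rpow_neg_one p, ← Real.rpow_add hp]
    norm_num
  rw [e1, e2]
  ring

/-- Everything cancels by (2n)! = 2ⁿ n! (2n-1)!! and Γ(n + 1/2) = (2n-1)!! √π / 2ⁿ. -/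
theorem dipole_constant (n : ℕ) :
    (((-2 * Real.pi) ^ n)⁻¹ * (((2 : ℝ) ^ n * (Nat.factorial n : ℝ))⁻¹ *
      ((Nat.factorial (n * 2) : ℝ) * (-1) ^ n))) * (Real.sqrt Real.pi ^ (n * 2 + 1) /
        Real.Gamma ((((n * 2 : ℕ) : ℝ) + 1) / 2)) = 1 := by
  have e : (((n * 2 : ℕ) : ℝ) + 1) / 2 = n + 1 / 2 := by push_cast; ring
  have h0 : Real.sqrt Real.pi ^ 2 = Real.pi := Real.sq_sqrt Real.pi_pos.le
  have h1 : Real.sqrt Real.pi ≠ 0 := (Real.sqrt_pos.2 Real.pi_pos).ne'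
  have h2 : (Nat.factorial (n * 2) : ℝ) = (2 : ℝ) ^ n * (Nat.factorial n : ℝ) *
      (Nat.doubleFactorial (2 * n - 1) : ℝ) := by
    rcases n with _ | n
    · simp
    · have := Nat.factorial_eq_mul_doubleFactorial (2 * n + 1)
      rw [show 2 * n + 1 + 1 = 2 * (n + 1) by ring, Nat.doubleFactorial_two_mul] at this
      rw [mul_comm (n + 1) 2, this, show 2 * (n + 1) - 1 = 2 * n + 1 by omega]
      push_cast; ring
  have h3 : (Nat.doubleFactorial (2 * n - 1) : ℝ) ≠ 0 := by
    exact_mod_cast (Nat.doubleFactorial_pos _).ne'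
  have h4 : (Nat.factorial n : ℝ) ≠ 0 := by exact_mod_cast (Nat.factorial_pos _).ne'
  have h5 := Real.pi_ne_zero
  rw [e, Real.Gamma_nat_add_half, h2, pow_succ, mul_comm n 2, pow_mul, h0,
    show -2 * Real.pi = (-1) * 2 * Real.pi by ring, mul_pow, mul_pow]
  have h6 : ((-1 : ℝ) ^ n) ≠ 0 := by positivity
  field_simp

end OddGC

namespace OddGC

open MeasureTheory

/-! ### The integrand of a graph -/

/-- The matrix D stands for dΛ, a combination of the rank one matrices given by the rows of c.
Sandwiching Y = Λ⁻¹ produces the entries of cYcᵀ, which puts dΛ Λ⁻¹ dΛ in the form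
`quadraticMatrix`. -/
theorem mul_mul_entry {R : Type*} [Ring R] [Algebra ℝ R] {k l : ℕ} (c : Matrix (Fin k) (Fin l) ℝ)
    (Y : Matrix (Fin l) (Fin l) ℝ) (d : Fin k → R) (D : Matrix (Fin l) (Fin l) R)
    (hD : ∀ i j, D i j = ∑ a, (c a i * c a j) • d a) (i j : Fin l) :
    (D * Y.map (algebraMap ℝ R) * D) i j = ∑ r : Fin k × Fin k,
      (c r.1 i * (c * Y * c.transpose) r.1 r.2 * c r.2 j) • (d r.1 * d r.2) := by
  have h1 : ∀ p q, D i p * Y.map (algebraMap ℝ R) p q * D q j = ∑ r : Fin k × Fin k,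
      (c r.1 i * (c r.1 p * Y p q * c r.2 q) * c r.2 j) • (d r.1 * d r.2) := by
    intro p q
    rw [hD, hD, Matrix.map_apply, ← Algebra.commutes, ← Algebra.smul_def, Finset.smul_sum,
      Finset.sum_mul_sum, Fintype.sum_prod_type]
    refine Finset.sum_congr rfl fun a _ => Finset.sum_congr rfl fun b _ => ?_
    rw [smul_smul, smul_mul_smul_comm]
    congr 1
    ring
  simp only [Matrix.mul_apply (M := D * _), Matrix.mul_apply (M := D), Finset.sum_mul, h1]
  have h2 : ∀ r : Fin k × Fin k, (c * Y * c.transpose) r.1 r.2 =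
      ∑ q, ∑ p, c r.1 p * Y p q * c r.2 q := by
    intro r
    simp [Matrix.mul_apply, Finset.sum_mul]
  simp only [h2, Finset.mul_sum, Finset.sum_mul, Finset.sum_smul]
  rw [Finset.sum_comm]
  conv_rhs => rw [Finset.sum_comm]
  conv_lhs => rw [Finset.sum_comm]
  refine Finset.sum_congr rfl fun q _ => ?_
  rw [Finset.sum_comm]

/-! ### The Pfaffian form of a graph in the affine chart -/

namespace HGraph

variable {G : HGraph}

/-- The edge order, when there is at least one edge. -/
def EdgeOrder.succ (ε : G.EdgeOrder) (h : 0 < Fintype.card G.E) :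
    Fin (Fintype.card G.E - 1 + 1) ≃ G.E := (finCongr (by omega)).trans ε

/-- The cycle matrix with rows in the given order. -/
def rowMatrix (ε : G.EdgeOrder) (h : 0 < Fintype.card G.E) (t : G.Direction) (C : G.CycleBasis) :
    Matrix (Fin (Fintype.card G.E - 1 + 1)) (Fin G.loops) ℝ :=
  (cycleMatrix t C).submatrix (ε.succ h) id

theorem chart_linear_succ (ε : G.EdgeOrder) (h : 0 < Fintype.card G.E)
    (y : Fin (Fintype.card G.E - 1) → ℝ) (i : Fin (Fintype.card G.E - 1 + 1)) :
    (chart ε).linear y (ε.succ h i) = Fin.cases 0 y i := by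
  have : (chart ε).linear y (ε.succ h i) = ((LinearMap.pi fun e =>
    if h : (ε.symm e : ℕ) = 0 then 0
    else LinearMap.proj (⟨(ε.symm e : ℕ) - 1, by have := (ε.symm e).2; omega⟩ :
      Fin (Fintype.card G.E - 1)) : (Fin (Fintype.card G.E - 1) → ℝ) →ₗ[ℝ] (G.E → ℝ)) + 0) y
        (ε.succ h i) := rfl
  rw [this]
  refine Fin.cases ?_ (fun a => ?_) i
  · simp [EdgeOrder.succ]
  · simp [EdgeOrder.succ]

theorem chart_succ (ε : G.EdgeOrder) (h : 0 < Fintype.card G.E)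
    (y : Fin (Fintype.card G.E - 1) → ℝ) (i : Fin (Fintype.card G.E - 1 + 1)) :
    chart ε y (ε.succ h i) = (Fin.cons 1 y : Fin (Fintype.card G.E - 1 + 1) → ℝ) i := by
  have : chart ε y (ε.succ h i) = (chart ε).linear y (ε.succ h i) +
      (if (ε.symm (ε.succ h i) : ℕ) = 0 then (1 : ℝ) else 0) := by
    have h0 := congrFun (AffineMap.decomp (chart ε)) y
    rw [h0]
    simp [chart]
  rw [this, chart_linear_succ]
  refine Fin.cases ?_ (fun a => ?_) i
  · simp [EdgeOrder.succ]
  · simp [EdgeOrder.succ]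

theorem dualLaplacian_apply (ε : G.EdgeOrder) (h : 0 < Fintype.card G.E) (t : G.Direction)
    (C : G.CycleBasis) (x : G.E → ℝ) :
    (dualLaplacian t C x : Matrix (Fin G.loops) (Fin G.loops) ℝ) =
      (rowMatrix ε h t C).transpose * Matrix.diagonal (x ∘ ε.succ h) * rowMatrix ε h t C := by
  ext i j
  have h1 : (dualLaplacian t C x : Matrix (Fin G.loops) (Fin G.loops) ℝ) i j =
    ((cycleMatrix t C).transpose * Matrix.diagonal x * cycleMatrix t C) i j := rfl
  rw [h1, Matrix.mul_apply, Matrix.mul_apply, ← (ε.succ h).sum_comp]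
  simp [rowMatrix, Matrix.mul_diagonal]

/-- The first edge variable is constant in the chart, so the first row of the cycle matrix drops out
of dΛ, although it still contributes to Λ. -/
theorem map_dX (ε : G.EdgeOrder) (h : 0 < Fintype.card G.E) (t : G.Direction) (C : G.CycleBasis)
    (i j : Fin G.loops) :
    ExteriorAlgebra.map (chart ε).linear.dualMap
      (ExteriorAlgebra.map (dualLaplacian t C).toAffineMap.linear.dualMap (dX G.loops i j)) =
    ∑ a, ((rowMatrix ε h t C).submatrix Fin.succ id a i *
      (rowMatrix ε h t C).submatrix Fin.succ id a j) • dy a := by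
  simp only [dX, Matrix.of_apply, ExteriorAlgebra.map_apply_ι, dy, ← map_smul, ← map_sum]
  congr 1
  ext z
  have h1 : ((dualLaplacian t C ((chart ε).linear (Pi.single z 1)) : SymMat G.loops) :
      Matrix (Fin G.loops) (Fin G.loops) ℝ) i j =
    ((chart ε).linear.dualMap ((dualLaplacian t C).toAffineMap.linear.dualMap
      ((Matrix.entryLinearMap ℝ ℝ i j).comp (SymMat G.loops).subtype))) (Pi.single z 1) := rfl
  simp only [LinearMap.comp_apply, LinearMap.single_apply]
  rw [← h1, dualLaplacian_apply ε h, Matrix.mul_apply, Fin.sum_univ_succ]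
  simp only [Matrix.mul_diagonal, Function.comp_apply, chart_linear_succ, Fin.cases_zero,
    Fin.cases_succ, mul_zero, zero_mul, zero_add, LinearMap.sum_apply, LinearMap.smul_apply,
    LinearMap.proj_apply, smul_eq_mul, Matrix.submatrix_apply, Matrix.transpose_apply, id]
  exact Finset.sum_congr rfl fun a _ => by ring

theorem integrand_eq (ε : G.EdgeOrder) (h : 0 < Fintype.card G.E) (t : G.Direction)
    (C : G.CycleBasis) (y : Fin (Fintype.card G.E - 1) → ℝ) :
    integrand ε t C y =
      (Real.sqrt ((rowMatrix ε h t C).transpose * Matrix.diagonal (Fin.cons 1 y) *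
          rowMatrix ε h t C).det)⁻¹ *
        topCoeff _ (pfaffian (quadraticMatrix ((rowMatrix ε h t C).submatrix Fin.succ id)
          ((rowMatrix ε h t C * ((rowMatrix ε h t C).transpose *
            Matrix.diagonal (Fin.cons 1 y) * rowMatrix ε h t C)⁻¹ *
              (rowMatrix ε h t C).transpose).submatrix Fin.succ Fin.succ))) := by
  have hx : chart ε y ∘ ε.succ h = Fin.cons 1 y := funext fun i => chart_succ ε h y i
  unfold integrand DForm.pullback graphForm DForm.pullback pfaffianForm
  rw [map_smul, map_smul, map_smul, smul_eq_mul, map_pfaffian, map_pfaffian]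
  have h1 : (((dualLaplacian t C).toAffineMap (chart ε y) : SymMat G.loops) :
      Matrix (Fin G.loops) (Fin G.loops) ℝ) =
    (rowMatrix ε h t C).transpose * Matrix.diagonal (Fin.cons 1 y) * rowMatrix ε h t C := by
    rw [← hx]; exact dualLaplacian_apply ε h t C _
  rw [h1]
  congr 3
  ext i j
  rw [quadraticMatrix, Matrix.of_apply]
  have h2 := mul_mul_entry ((rowMatrix ε h t C).submatrix Fin.succ id)
    ((rowMatrix ε h t C).transpose * Matrix.diagonal (Fin.cons 1 y) * rowMatrix ε h t C)⁻¹ dy _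
    (fun i j => map_dX ε h t C i j) i j
  refine Eq.trans ?_ h2
  simp only [Matrix.map_apply, Matrix.mul_apply, map_sum, map_mul, AlgHom.commutes]
  rfl

theorem integrand_eq_zero (ε : G.EdgeOrder) (t : G.Direction) (C : G.CycleBasis)
    (hl : G.loops + 1 ≠ Fintype.card G.E ∨ ¬ Even G.loops) (h : 0 < Fintype.card G.E)
    (y : Fin (Fintype.card G.E - 1) → ℝ) : integrand ε t C y = 0 := by
  rw [integrand_eq ε h]
  rcases hl with hl | hl
  · rw [topCoeff_pfaffian_of_ne (by omega), mul_zero]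
  · rw [pfaffian_of_odd hl, map_zero, mul_zero]

theorem simplex_eq_empty (h : ¬ 0 < Fintype.card G.E) : G.simplex = ∅ := by
  ext y; simp only [simplex, Set.mem_ofPred_eq, h, false_and, Set.mem_empty_iff_false]

theorem volume_restrict_simplex (h : 0 < Fintype.card G.E) :
    volume.restrict G.simplex = orthant (Fintype.card G.E - 1) := by
  rw [← restrict_orthant]
  congr 1
  ext y
  simp [simplex, h]

end HGraph

/-! ### The explicit integrand in corank one -/

-- The sizes k and l are tied to n by equations so that the lemma applies to the number of edges and
-- the loop number, which are not literally n * 2.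
open Matrix in
theorem corank_one_integrand {k l n : ℕ} (hl : l = n * 2) (hk : k = n * 2)
    (c : Matrix (Fin (k + 1)) (Fin l) ℝ) (A : Matrix (Fin (k + 1)) (Fin (k + 1)) ℝ)
    (b P : Fin (k + 1) → ℝ) (hA : ∀ i j, A i j = if h : (j : ℕ) < l then c i ⟨j, h⟩ else P i)
    (hdet : A.det ^ 2 = 1) (hb : b ᵥ* c = 0) (hP : b ⬝ᵥ P = 1)
    (hb1 : ∀ e, b e = 0 ∨ b e ^ 2 = 1) (y : Fin k → ℝ) (hy : ∀ a, 0 < y a) :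
    (Real.sqrt (cᵀ * diagonal (Fin.cons 1 y) * c).det)⁻¹ *
        topCoeff k (pfaffian (quadraticMatrix (c.submatrix Fin.succ id)
          ((c * (cᵀ * diagonal (Fin.cons 1 y) * c)⁻¹ * cᵀ).submatrix Fin.succ Fin.succ))) =
      (A.det * ∏ e, b e) * (((2 : ℝ) ^ n * (Nat.factorial n : ℝ))⁻¹ *
        ((Nat.factorial (n * 2) : ℝ) * (-1) ^ n)) *
      ((1 / (1 + ∑ a, (y a)⁻¹)) ^ (((k : ℝ) + 1) / 2) * ∏ a, y a ^ (-(3 / 2) : ℝ)) := by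
  subst hl hk
  have hA' : A = appendCol c P := by
    ext i j
    rw [hA]
    refine Fin.lastCases ?_ (fun j => ?_) j
    · simp [appendCol]
    · simp [appendCol]
  subst hA'
  have hx : ∀ e, 0 < (Fin.cons 1 y : Fin (n * 2 + 1) → ℝ) e :=
    Fin.cases (by simp) (fun a => by simpa using hy a)
  rw [topCoeff_corank_one hx hb hP hdet, det_laplacian hx hb hP hdet]
  by_cases h0 : ∀ e, b e ^ 2 = 1
  · have hq : invForm b (Fin.cons 1 y) = 1 + ∑ a, (y a)⁻¹ := by
      simp [invForm, Fin.sum_univ_succ, h0]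
    rw [hq, ← dipole_integrand_eq hy, Fin.prod_univ_succ, Fin.prod_univ_succ, neg_pow]
    simp only [Fin.cons_zero, Fin.cons_succ, one_mul, div_eq_mul_inv, Finset.prod_mul_distrib]
    ring
  -- If some bₑ vanishes, the form `invForm` is not 1 + ∑ 1/yₐ, but both sides contain the factor ∏
  -- bₑ = 0.
  · push Not at h0
    obtain ⟨e, he⟩ := h0
    have he : b e = 0 := (hb1 e).resolve_right he
    have h1 : ∏ e, b e = 0 := Finset.prod_eq_zero (Finset.mem_univ e) he
    have h2 : b 0 * ∏ a : Fin (n * 2), b a.succ = 0 := by rw [← Fin.prod_univ_succ, h1]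
    rw [h1, Finset.prod_div_distrib]
    have h3 : ∀ r s u w v z : ℝ, r * (s * (u * b 0 * (w * (v * ((∏ a : Fin (n * 2), b a.succ) / z)))))
      = (b 0 * ∏ a : Fin (n * 2), b a.succ) * (r * s * u * w * v / z) := by intros; ring
    rw [h3, h2]
    ring

end OddGC

namespace OddGC

open MeasureTheory

namespace HGraph

variable {G : HGraph}

/-! ### Chains and boundaries -/

theorem edge_flip (h : G.H) : G.edge (G.flip h) = G.edge h :=
  ((G.edge_eq_iff h (G.flip h)).2 (Or.inr rfl)).symm

theorem eq_tail_or (t : G.Direction) (h : G.H) :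
    h = t.tail (G.edge h) ∨ h = G.flip (t.tail (G.edge h)) :=
  (G.edge_eq_iff _ _).1 (t.edge_tail _)

/-- The coefficient of a vertex in the boundary of a directed edge. -/
def incidence (t : G.Direction) (v : G.V) (e : G.E) : ℤ :=
  (if G.vert (G.flip (t.tail e)) = v then 1 else 0) - (if G.vert (t.tail e) = v then 1 else 0)

theorem endpoints (t : G.Direction) {u v : G.V} (huv : u ≠ v) {h : G.H}
    (hu : incidence t u (G.edge h) ≠ 0) (hv : incidence t v (G.edge h) ≠ 0) :
    (G.vert h = u ∧ G.vert (G.flip h) = v) ∨ (G.vert h = v ∧ G.vert (G.flip h) = u) := by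
  unfold incidence at hu hv
  have h2 := G.flip_flip (t.tail (G.edge h))
  rcases eq_tail_or t h with h1 | h1
  · rw [← h1] at hu hv
    grind
  · generalize t.tail (G.edge h) = x at *
    subst h1
    grind

theorem filter_edge (t : G.Direction) (e : G.E) :
    (Finset.univ.filter fun h => G.edge h = e) = {t.tail e, G.flip (t.tail e)} := by
  ext h
  simp only [Finset.mem_filter, Finset.mem_univ, true_and, Finset.mem_insert,
    Finset.mem_singleton]
  constructor
  · rintro rfl; exact eq_tail_or t h
  · rintro (rfl | rfl)
    · exact t.edge_tail e
    · rw [edge_flip, t.edge_tail]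

theorem sum_halfEdges {M : Type*} [AddCommMonoid M] (t : G.Direction) (F : G.H → M) :
    ∑ h, F h = ∑ e, (F (t.tail e) + F (G.flip (t.tail e))) := by
  rw [← Finset.sum_fiberwise Finset.univ G.edge F]
  refine Finset.sum_congr rfl fun e _ => ?_
  rw [filter_edge t e, Finset.sum_pair (G.flip_ne _).symm]

/-- The 1-chain with given coefficients of the directed edges. -/
def chainOf (t : G.Direction) (f : G.E → ℤ) : G.H → ℤ :=
  fun h => if h = t.tail (G.edge h) then f (G.edge h) else -f (G.edge h)

theorem chainOf_mem (t : G.Direction) (f : G.E → ℤ) : chainOf t f ∈ G.C1 := by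
  intro h
  unfold chainOf
  rw [edge_flip]
  rcases eq_tail_or t h with h1 | h1
  · have h2 : G.flip h ≠ t.tail (G.edge h) := fun h2 => G.flip_ne h (h2.trans h1.symm)
    rw [if_neg h2, if_pos h1]
  · have h2 : G.flip h = t.tail (G.edge h) := by
      conv_lhs => rw [h1]
      exact G.flip_flip _
    have h3 : h ≠ t.tail (G.edge h) := fun h3 => G.flip_ne h (h2.trans h3.symm)
    rw [if_pos h2, if_neg h3, neg_neg]

theorem chainOf_tail (t : G.Direction) (f : G.E → ℤ) (e : G.E) :
    chainOf t f (t.tail e) = f e := by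
  simp [chainOf, t.edge_tail]

theorem chain_ext (t : G.Direction) {c c' : G.H → ℤ} (hc : c ∈ G.C1) (hc' : c' ∈ G.C1)
    (h : ∀ e, c (t.tail e) = c' (t.tail e)) : c = c' := by
  funext x
  rcases eq_tail_or t x with h1 | h1
  · rw [h1, h]
  · rw [h1, hc, hc', h]

/-- Chains are determined by their coefficients along the directed edges. -/
def chainEquiv (t : G.Direction) : G.C1 ≃ₗ[ℤ] (G.E → ℤ) where
  toFun c e := (c : G.H → ℤ) (t.tail e)
  map_add' _ _ := rfl
  map_smul' _ _ := rfl
  invFun f := ⟨chainOf t f, chainOf_mem t f⟩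
  left_inv c := Subtype.ext (chain_ext t (chainOf_mem t (fun e => (c : G.H → ℤ) (t.tail e))) c.2
    fun e => chainOf_tail t (fun e => (c : G.H → ℤ) (t.tail e)) e)
  right_inv f := funext fun e => chainOf_tail t f e

theorem incidence_cases (t : G.Direction) (v : G.V) (e : G.E) :
    incidence t v e = 0 ∨ incidence t v e = 1 ∨ incidence t v e = -1 := by
  unfold incidence
  split_ifs <;> simp

theorem boundary_apply (t : G.Direction) {c : G.H → ℤ} (hc : c ∈ G.C1) (v : G.V) :
    G.boundary c v = ∑ e, incidence t v e * c (t.tail e) := by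
  change -∑ h : G.H, (if G.vert h = v then c h else 0) = _
  rw [sum_halfEdges t, ← Finset.sum_neg_distrib]
  refine Finset.sum_congr rfl fun e _ => ?_
  rw [hc, incidence]
  split_ifs <;> ring

theorem sum_boundary {c : G.H → ℤ} (hc : c ∈ G.C1) (t : G.Direction) :
    ∑ v, G.boundary c v = 0 := by
  simp only [boundary_apply t hc]
  rw [Finset.sum_comm]
  refine Finset.sum_eq_zero fun e _ => ?_
  rw [← Finset.sum_mul]
  simp [incidence]

/-- A graph has a direction of its edges. -/
theorem nonempty_direction (G : HGraph) : Nonempty G.Direction :=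
  ⟨⟨fun e => (G.edge_surj e).choose, fun e => (G.edge_surj e).choose_spec⟩⟩

theorem finrank_C1 (G : HGraph) : Module.finrank ℤ G.C1 = Fintype.card G.E := by
  obtain ⟨t⟩ := nonempty_direction G
  rw [(chainEquiv t).finrank_eq, Module.finrank_fintype_fun_eq_card]

/-- Rank-nullity for the boundary map on C₁, whose kernel is H₁. -/
theorem finrank_range_add_loops (G : HGraph) :
    Module.finrank ℤ (LinearMap.range (G.boundary.domRestrict G.C1)) + G.loops =
      Fintype.card G.E := by
  rw [← finrank_C1]
  refine Eq.trans ?_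
    (Submodule.finrank_quotient_add_finrank (LinearMap.ker (G.boundary.domRestrict G.C1)))
  rw [(G.boundary.domRestrict G.C1).quotKerEquivRange.finrank_eq]
  congr 1
  refine LinearEquiv.finrank_eq (LinearEquiv.symm ?_)
  exact
    { toFun := fun c => ⟨c.1.1, c.1.2, c.2⟩
      invFun := fun c => ⟨⟨c.1, c.2.1⟩, c.2.2⟩
      map_add' := fun _ _ => rfl
      map_smul' := fun _ _ => rfl
      left_inv := fun _ => rfl
      right_inv := fun _ => rfl }

/-- As many chains as edges that generate the lattice C₁ form a matrix that is surjective over ℤ,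
hence unimodular. -/
theorem isUnit_det_of_span (ε : G.EdgeOrder) (t : G.Direction)
    (w : Fin (Fintype.card G.E) → G.H → ℤ)
    (hw : ∀ z ∈ G.C1, ∃ a : Fin (Fintype.card G.E) → ℤ, z = ∑ j, a j • w j) :
    IsUnit (Matrix.of fun i j => w j (t.tail (ε i)) :
      Matrix (Fin (Fintype.card G.E)) (Fin (Fintype.card G.E)) ℤ).det := by
  rw [← Matrix.isUnit_iff_isUnit_det, ← Matrix.mulVec_surjective_iff_isUnit]
  intro f
  obtain ⟨a, ha⟩ := hw _ (chainOf_mem t (f ∘ ε.symm))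
  refine ⟨a, funext fun i => ?_⟩
  have h := congrFun ha (t.tail (ε i))
  rw [chainOf_tail] at h
  simp only [Function.comp_apply, Equiv.symm_apply_apply] at h
  rw [h]
  simp [Matrix.mulVec, dotProduct, mul_comm]

theorem mem_H1_iff {c : G.H → ℤ} : c ∈ G.H1 ↔ c ∈ G.C1 ∧ G.boundary c = 0 := by
  simp [H1]

/-- The columns `C₁, …, C_ℓ, P`. -/
def cyclesWith (C : G.CycleBasis) (P : G.H → ℤ) (j : Fin (Fintype.card G.E)) : G.H → ℤ :=
  if h : (j : ℕ) < G.loops then C ⟨j, h⟩ else P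

/-- The hypothesis on v says that H₁ is cut out by the incidence row b of v alone, and P splits C₁
as H₁ ⊕ ℤP. So A is unimodular and the corank one formulas apply. Connectedness plays no role, which
serves convergence and the disconnected case. -/
theorem pfIntegral_corank_one (ε : G.EdgeOrder) (t : G.Direction) (C : G.CycleBasis) {v : G.V}
    (hv : ∀ z ∈ G.C1, G.boundary z v = 0 → G.boundary z = 0) {P : G.H → ℤ} (hP : P ∈ G.C1)
    (hPv : G.boundary P v = 1) (hl : G.loops + 1 = Fintype.card G.E) (he : Even G.loops)
    {A : Matrix (Fin (Fintype.card G.E)) (Fin (Fintype.card G.E)) ℤ}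
    (hA : A = Matrix.of fun i j => cyclesWith C P j (t.tail (ε i))) :
    IntegrableOn (integrand ε t C) G.simplex volume ∧
      pfIntegral ε t C = (A.det * ∏ e, incidence t v e : ℤ) ∧ IsUnit A.det := by
  have h0 : 0 < Fintype.card G.E := by omega
  have hunit : IsUnit A.det := by
    rw [hA]
    refine isUnit_det_of_span ε t _ fun z hz => ?_
    set r := G.boundary z v with hr
    -- Subtracting r copies of P kills the boundary at v, hence the whole boundary.
    have hz' : z - r • P ∈ G.H1 := by
      have h1 : z - r • P ∈ G.C1 := G.C1.sub_mem hz (G.C1.smul_mem r hP)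
      refine mem_H1_iff.2 ⟨h1, hv _ h1 ?_⟩
      rw [map_sub, map_smul, Pi.sub_apply, Pi.smul_apply, hPv, ← hr]
      simp
    have h2 := congrArg (Subtype.val) (C.sum_repr ⟨_, hz'⟩)
    rw [AddSubmonoidClass.coe_finsetSum] at h2
    let E : Fin G.loops ⊕ Fin 1 ≃ Fin (Fintype.card G.E) :=
      finSumFinEquiv.trans (finCongr hl)
    refine ⟨fun j => Sum.elim (fun i => C.repr ⟨_, hz'⟩ i) (fun _ => r) (E.symm j), ?_⟩
    rw [← E.sum_comp, Fintype.sum_sum_type]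
    have h3 : ∀ i, cyclesWith C P (E (Sum.inl i)) = C i := by
      intro i
      have : ((E (Sum.inl i) : Fin _) : ℕ) = i := rfl
      rw [cyclesWith, dif_pos (by rw [this]; exact i.2)]
      rfl
    have h4 : ∀ i, cyclesWith C P (E (Sum.inr i)) = P := by
      intro i
      have : ((E (Sum.inr i) : Fin _) : ℕ) = G.loops + i := rfl
      rw [cyclesWith, dif_neg (by rw [this]; omega)]
    simp only [Equiv.symm_apply_apply, Sum.elim_inl, Sum.elim_inr, h3, h4, Finset.univ_unique,
      Finset.sum_singleton]
    have h5 : ∑ i, C.repr ⟨_, hz'⟩ i • (C i : G.H → ℤ) = z - r • P := h2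
    rw [h5, sub_add_cancel]
  obtain ⟨n, hn⟩ : ∃ n, G.loops = n * 2 := ⟨G.loops / 2, by have := Nat.even_iff.1 he; omega⟩
  have hk : Fintype.card G.E - 1 = n * 2 := by omega
  set A' : Matrix (Fin (Fintype.card G.E - 1 + 1)) (Fin (Fintype.card G.E - 1 + 1)) ℝ :=
    (A.map (Int.castRingHom ℝ)).submatrix (finCongr (by omega)) (finCongr (by omega)) with hA'
  have hdet : A'.det = (A.det : ℝ) := by
    rw [hA', Matrix.det_submatrix_equiv_self]
    exact (Int.castRingHom ℝ).map_det A |>.symm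
  have hint : ∀ y : Fin (Fintype.card G.E - 1) → ℝ, (∀ a, 0 < y a) → integrand ε t C y =
      ((A.det : ℝ) * ∏ e, (incidence t v e : ℝ)) * (((2 : ℝ) ^ n * (Nat.factorial n : ℝ))⁻¹ *
        ((Nat.factorial (n * 2) : ℝ) * (-1) ^ n)) *
      ((1 / (1 + ∑ a, (y a)⁻¹)) ^ (((Fintype.card G.E - 1 : ℕ) + 1 : ℝ) / 2) *
        ∏ a, y a ^ (-(3 / 2) : ℝ)) := by
    intro y hy
    rw [integrand_eq ε h0, ← (ε.succ h0).prod_comp, ← hdet]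
    refine corank_one_integrand hn hk (rowMatrix ε h0 t C) A'
      (fun i => (incidence t v (ε.succ h0 i) : ℝ)) (fun i => (P (t.tail (ε.succ h0 i)) : ℝ))
      ?_ ?_ ?_ ?_ ?_ y hy
    · intro i j
      have hj : ((finCongr (by omega : Fintype.card G.E - 1 + 1 = Fintype.card G.E) j : Fin _) : ℕ)
        = j := rfl
      simp only [hA', hA, Matrix.submatrix_apply, Matrix.map_apply, Matrix.of_apply, cyclesWith]
      simp only [hj]
      split_ifs <;> rfl
    · rw [hdet]
      rcases Int.isUnit_iff.1 hunit with h | h <;> simp [h]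
    · ext j
      have h1 := boundary_apply t (mem_H1_iff.1 (C j).2).1 v
      rw [(mem_H1_iff.1 (C j).2).2, ← (ε.succ h0).sum_comp] at h1
      have h2 := congrArg (Int.cast : ℤ → ℝ) h1
      push_cast at h2
      simp only [Pi.zero_apply, Int.cast_zero] at h2
      exact h2.symm
    · have h1 := boundary_apply t hP v
      rw [hPv, ← (ε.succ h0).sum_comp] at h1
      have h2 := congrArg (Int.cast : ℤ → ℝ) h1
      push_cast at h2
      exact h2.symm
    · intro e
      rcases incidence_cases t v (ε.succ h0 e) with h | h | h <;> simp [h]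
  have hae : integrand ε t C =ᵐ[orthant (Fintype.card G.E - 1)] fun y =>
      ((A.det : ℝ) * ∏ e, (incidence t v e : ℝ)) * (((2 : ℝ) ^ n * (Nat.factorial n : ℝ))⁻¹ *
        ((Nat.factorial (n * 2) : ℝ) * (-1) ^ n)) *
      ((1 / (1 + ∑ a, (y a)⁻¹)) ^ (((Fintype.card G.E - 1 : ℕ) + 1 : ℝ) / 2) *
        ∏ a, y a ^ (-(3 / 2) : ℝ)) := by
    filter_upwards [ae_orthant _] with y hy
    exact hint y hy
  refine ⟨?_, ?_, hunit⟩
  · rw [IntegrableOn, volume_restrict_simplex h0]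
    exact ((integrable_dipole _).const_mul _).congr hae.symm
  · have h2 := dipole_constant n
    rw [pfIntegral, volume_restrict_simplex h0, integral_congr_ae hae, integral_const_mul,
      integral_dipole, show G.loops / 2 = n by omega]
    rw [hk]
    rw [Int.cast_mul, Int.cast_prod]
    linear_combination ((A.det : ℝ) * ∏ e, (incidence t v e : ℝ)) * h2

/-- A graph with `ℓ = m - 1` has a vertex that detects the boundary of every chain. -/
theorem exists_detecting_vertex (hl : G.loops + 1 = Fintype.card G.E) :
    ∃ v : G.V, (∀ z ∈ G.C1, G.boundary z v = 0 → G.boundary z = 0) ∧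
      ∃ P ∈ G.C1, G.boundary P v = 1 := by
  have hr : Module.finrank ℤ (LinearMap.range (G.boundary.domRestrict G.C1)) = 1 := by
    have := finrank_range_add_loops G; omega
  obtain ⟨t⟩ := nonempty_direction G
  -- If all edges were self-loops, the boundary map would be zero instead of having rank one.
  obtain ⟨e, he⟩ : ∃ e, G.vert (G.flip (t.tail e)) ≠ G.vert (t.tail e) := by
    by_contra! h
    have h0 : LinearMap.range (G.boundary.domRestrict G.C1) = ⊥ := by
      rw [LinearMap.range_eq_bot]
      ext c v
      change G.boundary c.1 v = 0
      rw [boundary_apply t c.2]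
      simp [incidence, h]
    rw [h0, finrank_bot] at hr
    exact zero_ne_one hr
  have hb : ∀ v, G.boundary (chainOf t (Pi.single e 1)) v = incidence t v e := by
    intro v
    rw [boundary_apply t (chainOf_mem t _)]
    simp [chainOf_tail, Pi.single_apply]
  have hP : G.boundary (chainOf t (Pi.single e 1)) (G.vert (G.flip (t.tail e))) = 1 := by
    rw [hb, incidence, if_pos rfl, if_neg he.symm, sub_zero]
  refine ⟨G.vert (G.flip (t.tail e)), fun z hz h0 => ?_, _, chainOf_mem t _, hP⟩
  by_contra hne
  -- A nonzero boundary vanishing at v and a boundary with value 1 at v are independent, which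
  -- contradicts rank one.
  have hli : LinearIndependent ℤ
      ![(⟨G.boundary z, ⟨⟨z, hz⟩, rfl⟩⟩ : LinearMap.range (G.boundary.domRestrict G.C1)),
        ⟨G.boundary (chainOf t (Pi.single e 1)), ⟨⟨_, chainOf_mem t _⟩, rfl⟩⟩] := by
    rw [LinearIndependent.pair_iff]
    intro a b hab
    have h1 : a • G.boundary z + b • G.boundary (chainOf t (Pi.single e 1)) = 0 :=
      congrArg Subtype.val hab
    have h2 := congrFun h1 (G.vert (G.flip (t.tail e)))
    simp only [Pi.add_apply, Pi.smul_apply, h0, hP, smul_eq_mul, mul_zero, zero_add, mul_one,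
      Pi.zero_apply] at h2
    rw [h2, zero_smul, add_zero] at h1
    exact ⟨(smul_eq_zero.1 h1).resolve_right hne, h2⟩
  have := hli.fintype_card_le_finrank
  rw [hr, Fintype.card_fin] at this
  omega

/-- Outside the even corank one case the integrand is identically zero or the simplex is empty. -/
theorem integrableOn_integrand (ε : G.EdgeOrder) (t : G.Direction) (C : G.CycleBasis) :
    IntegrableOn (integrand ε t C) G.simplex volume := by
  by_cases h0 : 0 < Fintype.card G.E
  · by_cases hl : G.loops + 1 = Fintype.card G.E ∧ Even G.loops
    · obtain ⟨v, hv, P, hP, hPv⟩ := exists_detecting_vertex hl.1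
      exact (pfIntegral_corank_one ε t C hv hP hPv hl.1 hl.2 rfl).1
    · rw [not_and_or] at hl
      rw [show integrand ε t C = fun _ => 0 from funext (integrand_eq_zero ε t C hl h0)]
      exact integrableOn_zero
  · rw [simplex_eq_empty h0]; exact integrableOn_empty

theorem pfIntegral_eq_zero (ε : G.EdgeOrder) (t : G.Direction) (C : G.CycleBasis)
    (hl : ¬ (G.loops + 1 = Fintype.card G.E ∧ Even G.loops)) : pfIntegral ε t C = 0 := by
  unfold pfIntegral
  by_cases h0 : 0 < Fintype.card G.E
  · rw [not_and_or] at hl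
    rw [show integrand ε t C = fun _ => 0 from funext (integrand_eq_zero ε t C hl h0)]
    simp
  · rw [simplex_eq_empty h0]; simp

/-- The integrals of disconnected graphs without isolated vertices vanish. -/
theorem pfIntegral_of_not_connected (hG : ∀ v : G.V, ∃ h, G.vert h = v) (hc : ¬ G.Connected)
    (ε : G.EdgeOrder) (t : G.Direction) (C : G.CycleBasis) : pfIntegral ε t C = 0 := by
  by_cases hl : G.loops + 1 = Fintype.card G.E ∧ Even G.loops
  · obtain ⟨v, hv, P, hP, hPv⟩ := exists_detecting_vertex hl.1
    rw [(pfIntegral_corank_one ε t C hv hP hPv hl.1 hl.2 rfl).2.1]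
    by_contra hne
    have hinc : ∀ e, incidence t v e ≠ 0 := fun e h => hne (by
      rw [Finset.prod_eq_zero (Finset.mem_univ e) h]; simp)
    -- The boundary has rank one: the combination of e and e' that cancels at v has boundary zero
    -- everywhere.
    have key : ∀ e e' w, incidence t w e * incidence t v e' = incidence t w e' * incidence t v e := by
      intro e e' w
      have h1 := hv (incidence t v e' • chainOf t (Pi.single e 1) -
        incidence t v e • chainOf t (Pi.single e' 1))
        (G.C1.sub_mem (G.C1.smul_mem _ (chainOf_mem t _)) (G.C1.smul_mem _ (chainOf_mem t _)))
      have hb : ∀ e w, G.boundary (chainOf t (Pi.single e 1)) w = incidence t w e := by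
        intro e w
        rw [boundary_apply t (chainOf_mem t _)]
        simp [chainOf_tail, Pi.single_apply]
      have h2 : ∀ w, G.boundary (incidence t v e' • chainOf t (Pi.single e 1) -
        incidence t v e • chainOf t (Pi.single e' 1)) w = incidence t v e' * incidence t w e -
          incidence t v e * incidence t w e' := by
        intro w
        rw [map_sub, map_smul, map_smul, Pi.sub_apply, Pi.smul_apply, Pi.smul_apply, hb, hb]
        rfl
      have h3 := congrFun (h1 (by rw [h2]; ring)) w
      rw [h2, Pi.zero_apply] at h3
      linarith
    obtain ⟨e₀⟩ : Nonempty G.E := Fintype.card_pos_iff.1 (by omega)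
    -- Take for u the other end of e₀. By proportionality of the incidence rows it is an end of
    -- every edge, so all edges join u and v. As no vertex is isolated, the graph is then connected.
    obtain ⟨u, huv, hu0⟩ : ∃ u, u ≠ v ∧ incidence t u e₀ ≠ 0 := by
      have h0 := hinc e₀
      unfold incidence at h0 ⊢
      by_cases h1 : G.vert (t.tail e₀) = v
      · refine ⟨G.vert (G.flip (t.tail e₀)), ?_, ?_⟩ <;> grind
      · exact ⟨G.vert (t.tail e₀), h1, by grind⟩
    have hu : ∀ e, incidence t u e ≠ 0 := fun e h => by
      have := key e e₀ u
      rw [h, zero_mul] at this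
      exact mul_ne_zero hu0 (hinc e) this.symm
    have hE := fun h => endpoints t huv (hu (G.edge h)) (hinc (G.edge h))
    have hV : ∀ a, a = u ∨ a = v := by
      intro a
      obtain ⟨h, rfl⟩ := hG a
      rcases hE h with h1 | h1
      · exact Or.inl h1.1
      · exact Or.inr h1.1
    obtain ⟨h₁, h₂⟩ : (∃ h, G.vert h = u ∧ G.vert (G.flip h) = v) ∧
        ∃ h, G.vert h = v ∧ G.vert (G.flip h) = u := by
      have h2 := G.flip_flip (t.tail e₀)
      rcases hE (t.tail e₀) with h1 | h1
      · exact ⟨⟨_, h1⟩, ⟨G.flip (t.tail e₀), h1.2, by rw [h2, h1.1]⟩⟩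
      · exact ⟨⟨G.flip (t.tail e₀), h1.2, by rw [h2, h1.1]⟩, ⟨_, h1⟩⟩
    refine hc ⟨⟨v⟩, fun a b => ?_⟩
    rcases hV a with rfl | rfl <;> rcases hV b with rfl | rfl
    · exact .refl
    · exact .single h₁
    · exact .single h₂
    · exact .refl
  · exact pfIntegral_eq_zero ε t C hl

end HGraph

end OddGC

namespace OddGC

namespace HGraph

variable {G : HGraph}

/-! ### Presentations of connected graphs -/

theorem exists_path {u v : G.V}
    (h : Relation.ReflTransGen (fun a b => ∃ h, G.vert h = a ∧ G.vert (G.flip h) = b) u v) :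
    ∃ P ∈ G.C1, G.boundary P = Pi.single v 1 - Pi.single u 1 := by
  induction h with
  | refl => exact ⟨0, G.C1.zero_mem, by simp⟩
  | tail _ hab ih =>
    obtain ⟨P, hP, hb⟩ := ih
    obtain ⟨h, rfl, rfl⟩ := hab
    refine ⟨P + (Pi.single h 1 - Pi.single (G.flip h) 1), G.C1.add_mem hP fun x => ?_, ?_⟩
    · have h1 : G.flip x = h ↔ x = G.flip h :=
        ⟨fun e => by rw [← e, G.flip_flip], fun e => by rw [e, G.flip_flip]⟩
      have h2 : G.flip x = G.flip h ↔ x = h :=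
        ⟨fun e => by rw [← G.flip_flip x, e, G.flip_flip], fun e => by rw [e]⟩
      simp only [Pi.sub_apply, Pi.single_apply, h1, h2]
      ring
    · have h1 : ∀ x : G.H, G.boundary (Pi.single x 1) = -Pi.single (G.vert x) 1 := by
        intro x
        ext v
        change -∑ h : G.H, (if G.vert h = v then (Pi.single x 1 : G.H → ℤ) h else 0) = _
        rw [Finset.sum_eq_single x (fun y _ hy => by simp [Pi.single_eq_of_ne hy]) (by simp)]
        simp [Pi.single_apply, eq_comm]
      rw [map_add, hb, map_sub, h1, h1]
      abel

theorem Connected.nonempty_presentation (hG : G.Connected) : Nonempty (Presentation G) := by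
  obtain ⟨t⟩ := nonempty_direction G
  have hpos : 0 < Fintype.card G.V := by
    have := hG.1
    exact Fintype.card_pos
  choose P hP hb using fun k : Fin (Fintype.card G.V) =>
    exists_path (hG.2 ((Fintype.equivFin G.V).symm ⟨0, hpos⟩) ((Fintype.equivFin G.V).symm k))
  exact ⟨{
    frame := ⟨(Fintype.equivFin G.V).symm, t⟩
    edges := (Fintype.equivFin G.E).symm
    cycles := Module.finBasis ℤ G.H1
    path := P
    path_mem := hP
    boundary_path := fun k k₁ h => by
      obtain rfl : k₁ = ⟨0, hpos⟩ := Fin.ext h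
      exact hb k }⟩

namespace Presentation

/-- A boundary has coefficient sum zero, so it is determined by its coefficients at the vertices
other than the first. -/
theorem boundary_eq_sum (p : Presentation G) {N : ℕ} (hN : N + 1 = Fintype.card G.V) {z : G.H → ℤ}
    (hz : z ∈ G.C1) :
    G.boundary z = ∑ k : Fin N, G.boundary z (p.frame.order (finCongr hN k.succ)) •
      G.boundary (p.path (finCongr hN k.succ)) := by
  have h0 : ∀ k, G.boundary (p.path (finCongr hN k)) =
      Pi.single (p.frame.order (finCongr hN k)) 1 - Pi.single (p.frame.order (finCongr hN 0)) 1 :=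
    fun k => p.boundary_path _ _ rfl
  have hs := sum_boundary hz p.frame.dir
  rw [← ((finCongr hN).trans p.frame.order).sum_comp, Fin.sum_univ_succ] at hs
  ext v
  obtain ⟨j, rfl⟩ := ((finCongr hN).trans p.frame.order).surjective v
  simp only [Equiv.trans_apply] at hs ⊢
  simp only [h0, Finset.sum_apply, Pi.smul_apply, Pi.sub_apply, Pi.single_apply,
    EmbeddingLike.apply_eq_iff_eq, smul_eq_mul]
  refine Fin.cases ?_ (fun j => ?_) j
  · simp only [(Fin.succ_ne_zero _).symm, if_false, if_true]
    simp only [zero_sub, mul_neg, mul_one, Finset.sum_neg_distrib]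
    linarith
  · simp [Fin.succ_ne_zero]

theorem linearIndependent_boundary_path (p : Presentation G) {N : ℕ} (hN : N + 1 = Fintype.card G.V) :
    LinearIndependent ℤ fun k : Fin N => G.boundary (p.path (finCongr hN k.succ)) := by
  have h0 : ∀ k, G.boundary (p.path (finCongr hN k)) =
      Pi.single (p.frame.order (finCongr hN k)) 1 - Pi.single (p.frame.order (finCongr hN 0)) 1 :=
    fun k => p.boundary_path _ _ rfl
  rw [Fintype.linearIndependent_iff]
  intro a ha j
  have h1 := congrFun ha (p.frame.order (finCongr hN j.succ))
  simp only [h0, Finset.sum_apply, Pi.smul_apply, Pi.sub_apply, Pi.single_apply,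
    EmbeddingLike.apply_eq_iff_eq, smul_eq_mul] at h1
  simpa [Fin.succ_ne_zero] using h1

/-- The Euler characteristic of a connected graph: the boundaries v_k - v₁ of the paths form a basis
of the image of the boundary map. Connectedness enters only through the existence of the paths. -/
theorem loops_add_card (p : Presentation G) {N : ℕ} (hN : N + 1 = Fintype.card G.V) : G.loops + N = Fintype.card G.E := by
  have h1 : LinearMap.range (G.boundary.domRestrict G.C1) =
      Submodule.span ℤ (Set.range fun k : Fin N => G.boundary (p.path (finCongr hN k.succ))) := by
    refine le_antisymm ?_ (Submodule.span_le.2 ?_)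
    · rintro _ ⟨z, rfl⟩
      change G.boundary z.1 ∈ _
      rw [p.boundary_eq_sum hN z.2]
      exact Submodule.sum_mem _ fun k _ =>
        Submodule.smul_mem _ _ (Submodule.subset_span ⟨k, rfl⟩)
    · rintro _ ⟨k, rfl⟩
      exact ⟨⟨_, p.path_mem _⟩, rfl⟩
  have h2 := finrank_range_add_loops G
  rw [h1, finrank_span_eq_card (p.linearIndependent_boundary_path hN), Fintype.card_fin] at h2
  omega

/-- The columns of `matrixA`. -/
def column (p : Presentation G) (j : Fin (Fintype.card G.E)) : G.H → ℤ :=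
  if h : (j : ℕ) < G.loops then p.cycles ⟨j, h⟩
  else if h' : (j : ℕ) - G.loops + 1 < Fintype.card G.V then
    p.path ⟨(j : ℕ) - G.loops + 1, h'⟩
  else 0

theorem matrixA_eq (p : Presentation G) :
    p.matrixA = Matrix.of fun i j => p.column j (p.frame.dir.tail (p.edges i)) := by
  ext i j
  simp only [matrixA, column, Matrix.of_apply]
  split_ifs <;> rfl

/-- Subtracting from a chain the paths with the same boundary leaves a cycle, so cycles and paths
together generate C₁. -/
theorem isUnit_det_matrixA (p : Presentation G) {N : ℕ} (hN : N + 1 = Fintype.card G.V) : IsUnit p.matrixA.det := by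
  have hl := p.loops_add_card hN
  rw [matrixA_eq]
  refine isUnit_det_of_span _ _ _ fun z hz => ?_
  have hz' : z - ∑ k : Fin N, G.boundary z (p.frame.order (finCongr hN k.succ)) •
      p.path (finCongr hN k.succ) ∈ G.H1 := by
    refine mem_H1_iff.2 ⟨G.C1.sub_mem hz (Submodule.sum_mem _ fun k _ =>
      G.C1.smul_mem _ (p.path_mem _)), ?_⟩
    rw [map_sub, map_sum]
    simp only [map_smul]
    rw [← p.boundary_eq_sum hN hz, sub_self]
  have h2 := congrArg (Subtype.val) (p.cycles.sum_repr ⟨_, hz'⟩)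
  rw [AddSubmonoidClass.coe_finsetSum] at h2
  let E : Fin G.loops ⊕ Fin N ≃ Fin (Fintype.card G.E) := finSumFinEquiv.trans (finCongr hl)
  refine ⟨fun j => Sum.elim (fun i => p.cycles.repr ⟨_, hz'⟩ i)
    (fun k => G.boundary z (p.frame.order (finCongr hN k.succ))) (E.symm j), ?_⟩
  rw [← E.sum_comp, Fintype.sum_sum_type]
  have h3 : ∀ i, p.column (E (Sum.inl i)) = p.cycles i := by
    intro i
    have : ((E (Sum.inl i) : Fin _) : ℕ) = i := rfl
    rw [column, dif_pos (by rw [this]; exact i.2)]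
    rfl
  have h4 : ∀ i, p.column (E (Sum.inr i)) = p.path (finCongr hN i.succ) := by
    intro i
    have h5 : ((E (Sum.inr i) : Fin _) : ℕ) = G.loops + i := rfl
    rw [column, dif_neg (by rw [h5]; omega), dif_pos (by rw [h5]; omega)]
    congr 1
    ext
    simp [h5]
  simp only [Equiv.symm_apply_apply, Sum.elim_inl, Sum.elim_inr, h3, h4]
  have h5 : ∑ i, p.cycles.repr ⟨_, hz'⟩ i • (p.cycles i : G.H → ℤ) = _ := h2
  rw [h5]
  exact (sub_add_cancel _ _).symm

end Presentation

/-- The number computed by the canonical integral: for a graph with two vertices and an odd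
number of edges, the sign that compares the orientation with the one where all edges are directed
from the first to the second vertex, and zero if there is a loop edge. -/
def dipoleSign (o : Orientation G) (d : G.Frame) : ℤ :=
  if h : Fintype.card G.V = 2 ∧ Odd (Fintype.card G.E) then
    (o.coeff d : ℤ) * ∏ e, incidence d.dir (d.order ⟨1, by omega⟩) e
  else 0

/-- By the Euler characteristic, ℓ = m - 1 means two vertices, and the second one detects
boundaries. -/
theorem Presentation.value_eq (p : Presentation G) (hG : G.Connected) (o : Orientation G) :
    p.value o = dipoleSign o p.frame := by
  have hpos : 0 < Fintype.card G.V := by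
    have := hG.1
    exact Fintype.card_pos
  have hl := p.loops_add_card (N := Fintype.card G.V - 1) (by omega)
  unfold dipoleSign Presentation.value
  split_ifs with h
  · have hN : 1 + 1 = Fintype.card G.V := h.1.symm
    have hl1 : G.loops + 1 = Fintype.card G.E := by omega
    have he : Even G.loops := by
      have := h.2
      rw [← hl1, Nat.odd_add_one, Nat.not_odd_iff_even] at this
      exact this
    have h1 : (finCongr hN 1 : Fin (Fintype.card G.V)) = ⟨1, by omega⟩ := rfl
    obtain ⟨-, hval, hu⟩ := pfIntegral_corank_one p.edges p.frame.dir p.cycles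
      (v := p.frame.order ⟨1, by omega⟩) (P := p.path ⟨1, by omega⟩) (A := p.matrixA)
      (fun z hz h0 => by
        rw [p.boundary_eq_sum hN hz, Fin.sum_univ_one]
        change G.boundary z (p.frame.order ⟨1, _⟩) • _ = 0
        rw [h0, zero_smul])
      (p.path_mem _)
      (by
        rw [p.boundary_path _ ⟨0, hpos⟩ rfl]
        simp)
      hl1 he
      (by
        rw [p.matrixA_eq]
        ext i j
        simp only [Matrix.of_apply, Presentation.column, cyclesWith]
        split_ifs with h2 h3
        · rfl
        · congr 2
          omega
        · omega)
    rw [hval, Presentation.sign]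
    -- The determinant of A occurs both in the sign and in the integral, and its square is 1.
    rcases Int.isUnit_iff.1 hu with h2 | h2 <;> rw [h2] <;> push_cast <;> ring
  · rw [pfIntegral_eq_zero, mul_zero, Int.cast_zero]
    rintro ⟨h1, h2⟩
    refine h ⟨by omega, ?_⟩
    rw [← h1]
    exact h2.add_one

/-! ### Change of frame -/

theorem flip_incidence (t t' : G.Direction) (v : G.V) (e : G.E) :
    incidence t' v e = (if t.tail e = t'.tail e then 1 else -1) * incidence t v e := by
  unfold incidence
  have hne := G.flip_ne (t.tail e)
  rcases tail_cases t t' e with h | h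
  · rw [h, if_pos rfl, one_mul]
  · rw [h, if_neg hne.symm, G.flip_flip]
    ring

theorem perm_of_eq_two {n : ℕ} (h : n = 2) (σ : Equiv.Perm (Fin n)) :
    (Equiv.Perm.sign σ = 1 ∧ σ ⟨1, by omega⟩ = ⟨1, by omega⟩) ∨
      (Equiv.Perm.sign σ = -1 ∧ σ ⟨1, by omega⟩ = ⟨0, by omega⟩) := by
  subst h
  revert σ
  decide

theorem sum_incidence (t : G.Direction) (e : G.E) : ∑ v, incidence t v e = 0 := by
  simp [incidence]

theorem incidence_zero_one (h : Fintype.card G.V = 2) (q : Fin (Fintype.card G.V) ≃ G.V)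
    (t : G.Direction) (e : G.E) :
    incidence t (q ⟨0, by omega⟩) e = -incidence t (q ⟨1, by omega⟩) e := by
  have h1 := sum_incidence t e
  rw [← ((finCongr h.symm).trans q).sum_comp, Fin.sum_univ_two] at h1
  exact eq_neg_of_add_eq_zero_left h1

/-- Reversing an edge changes the coefficient and one incidence. Exchanging the two vertices changes
the coefficient and all incidences, an odd number of signs. Both changes cancel. -/
theorem dipoleSign_eq (o : Orientation G) (d d' : G.Frame) :
    dipoleSign o d' = dipoleSign o d := by
  unfold dipoleSign
  split_ifs with h
  · have key : ∀ e, incidence d.dir (d'.order ⟨1, by omega⟩) e =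
        ((Equiv.Perm.sign (d.order.trans d'.order.symm) : ℤˣ) : ℤ) *
          incidence d.dir (d.order ⟨1, by omega⟩) e := by
      intro e
      rcases perm_of_eq_two h.1 (d.order.trans d'.order.symm) with ⟨h1, h2⟩ | ⟨h1, h2⟩
      · rw [Equiv.trans_apply, Equiv.symm_apply_eq] at h2
        rw [h1, Units.val_one, one_mul, h2]
      · rw [Equiv.trans_apply, Equiv.symm_apply_eq] at h2
        rw [h1, h2, incidence_zero_one h.1]
        simp
    simp only [flip_incidence d.dir d'.dir, key, Finset.prod_mul_distrib, Finset.prod_const,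
      Finset.card_univ]
    rw [o.coeff_eq d d', relSign]
    push_cast
    generalize Equiv.Perm.sign (d.order.trans d'.order.symm) = s
    have hs : ((s : ℤˣ) : ℤ) * (s : ℤ) ^ Fintype.card G.E = 1 := by
      rcases Int.units_eq_one_or s with rfl | rfl
      · simp
      · simp [h.2.neg_one_pow]
    have ht : (∏ e, ((if d.dir.tail e = d'.dir.tail e then 1 else -1 : ℤˣ) : ℤ)) *
        ∏ e, (if d.dir.tail e = d'.dir.tail e then (1 : ℤ) else -1) = 1 := by
      rw [← Finset.prod_mul_distrib]
      refine Finset.prod_eq_one fun e _ => ?_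
      split_ifs <;> simp
    linear_combination ((o.coeff d : ℤ) * ∏ e, incidence d.dir (d.order ⟨1, by omega⟩) e) *
      (ht * (s : ℤ) * (s : ℤ) ^ Fintype.card G.E + hs)
  · rfl

theorem nonempty_frame (G : HGraph) : Nonempty G.Frame := by
  obtain ⟨t⟩ := nonempty_direction G
  exact ⟨⟨(Fintype.equivFin G.V).symm, t⟩⟩

theorem canonicalIntegral_eq (hG : G.Connected) (o : Orientation G) (d : G.Frame) :
    canonicalIntegral G o = dipoleSign o d := by
  rw [canonicalIntegral, dif_pos hG.nonempty_presentation, Presentation.value_eq _ hG,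
    dipoleSign_eq]

theorem Presentation.value_eq_canonicalIntegral (p : Presentation G) (hG : G.Connected)
    (o : Orientation G) : p.value o = canonicalIntegral G o := by
  rw [p.value_eq hG, canonicalIntegral_eq hG]

theorem Presentation.sign_cases (p : Presentation G) (hG : G.Connected) (o : Orientation G) :
    p.sign o = 1 ∨ p.sign o = -1 := by
  have hpos : 0 < Fintype.card G.V := by
    have := hG.1
    exact Fintype.card_pos
  have h := p.isUnit_det_matrixA (N := Fintype.card G.V - 1) (by omega)
  exact Int.isUnit_iff.1 ((o.coeff p.frame).isUnit.mul h)

end HGraph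

end OddGC

namespace OddGC

namespace HGraph

variable {G G' : HGraph}

/-! ### Isomorphisms -/

/-- Not part of the definition of `Iso`: the two halves of an edge go to distinct halves of the same
edge. -/
theorem Iso.onH_flip (φ : Iso G G') (h : G.H) : φ.onH (G.flip h) = G'.flip (φ.onH h) := by
  have h1 : G'.edge (φ.onH h) = G'.edge (φ.onH (G.flip h)) := by
    rw [φ.edge_onH, φ.edge_onH, edge_flip]
  exact ((G'.edge_eq_iff _ _).1 h1).resolve_left fun h2 => G.flip_ne h (φ.onH.injective h2)

/-- The image of a frame. -/
def Iso.mapFrame (φ : Iso G G') (d : G.Frame) : G'.Frame where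
  order := (finCongr (Fintype.card_congr φ.onV).symm).trans (d.order.trans φ.onV)
  dir := ⟨fun e => φ.onH (d.dir.tail (φ.onE.symm e)), fun e => by
    rw [φ.edge_onH, d.dir.edge_tail, Equiv.apply_symm_apply]⟩

theorem Iso.mapsFrame_mapFrame (φ : Iso G G') (d : G.Frame) : φ.MapsFrame d (φ.mapFrame d) := by
  constructor
  · intro i j h
    have : (finCongr (Fintype.card_congr φ.onV).symm) j = i := Fin.ext h.symm
    simp [mapFrame, this]
  · intro e
    simp [mapFrame]

theorem Iso.incidence_eq (φ : Iso G G') {d : G.Frame} {d' : G'.Frame} (hd : φ.MapsFrame d d')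
    (v : G.V) (e : G.E) : incidence d'.dir (φ.onV v) (φ.onE e) = incidence d.dir v e := by
  unfold incidence
  rw [← hd.2, ← φ.onH_flip, φ.vert_onH, φ.vert_onH]
  simp only [EmbeddingLike.apply_eq_iff_eq]

/-- The product of incidences is transported unchanged. In this cross-multiplied form nothing is
assumed about o and o', so the identity serves both to transport integrals and to recover
orientations from them. -/
theorem Iso.coeff_mul_dipoleSign (φ : Iso G G') {d : G.Frame} {d' : G'.Frame}
    (hd : φ.MapsFrame d d') (o : Orientation G) (o' : Orientation G') :
    (o.coeff d : ℤ) * dipoleSign o' d' = (o'.coeff d' : ℤ) * dipoleSign o d := by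
  have hV := Fintype.card_congr φ.onV
  have hE := Fintype.card_congr φ.onE
  unfold dipoleSign
  by_cases h : Fintype.card G.V = 2 ∧ Odd (Fintype.card G.E)
  · rw [dif_pos h, dif_pos (by rw [← hV, ← hE]; exact h), ← φ.onE.prod_comp,
      ← hd.1 ⟨1, by omega⟩ ⟨1, by omega⟩ rfl]
    simp only [φ.incidence_eq hd]
    ring
  · rw [dif_neg h, dif_neg (by rw [← hV, ← hE]; exact h)]
    simp

theorem Connected.of_iso (φ : Iso G G') (hG : G.Connected) : G'.Connected := by
  refine ⟨hG.1.map φ.onV, fun u v => ?_⟩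
  have h := (hG.2 (φ.onV.symm u) (φ.onV.symm v)).lift φ.onV
    (p := fun a b => ∃ h, G'.vert h = a ∧ G'.vert (G'.flip h) = b) (by
      rintro _ _ ⟨h, rfl, rfl⟩
      exact ⟨φ.onH h, φ.vert_onH h, by rw [← φ.onH_flip, φ.vert_onH]⟩)
  simpa [Function.onFun] using h

theorem canonicalIntegral_eq_of_iso (hG : G.Connected) {o : Orientation G} {o' : Orientation G'}
    (φ : Iso G G') (h : φ.MapsOrientation o o') :
    canonicalIntegral G o = canonicalIntegral G' o' := by
  obtain ⟨d⟩ := nonempty_frame G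
  have h1 := φ.coeff_mul_dipoleSign (φ.mapsFrame_mapFrame d) o o'
  rw [h _ _ (φ.mapsFrame_mapFrame d)] at h1
  rw [canonicalIntegral_eq hG o d, canonicalIntegral_eq (hG.of_iso φ) o' (φ.mapFrame d),
    mul_left_cancel₀ (o.coeff d).ne_zero h1]

/-- A nonzero integral remembers the orientation. In particular, no automorphism of an odd dipole
reverses its orientation. -/
theorem mapsOrientation_of_canonicalIntegral_eq (hG : G.Connected) {o : Orientation G}
    {o' : Orientation G'} (φ : Iso G G') (h : canonicalIntegral G o = canonicalIntegral G' o')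
    (h0 : canonicalIntegral G o ≠ 0) : φ.MapsOrientation o o' := by
  intro d d' hd
  have h1 := φ.coeff_mul_dipoleSign hd o o'
  rw [canonicalIntegral_eq hG o d] at h h0
  rw [canonicalIntegral_eq (hG.of_iso φ) o' d'] at h
  rw [← Int.cast_injective h] at h1
  exact (Units.ext (mul_right_cancel₀ (by exact_mod_cast h0) h1)).symm

theorem canonicalIntegral_neg (hG : G.Connected) (o : Orientation G) :
    canonicalIntegral G (-o) = -canonicalIntegral G o := by
  obtain ⟨d⟩ := nonempty_frame G
  rw [canonicalIntegral_eq hG _ d, canonicalIntegral_eq hG _ d, ← Int.cast_neg]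
  congr 1
  unfold dipoleSign
  split_ifs
  · have : (-o).coeff d = -o.coeff d := rfl
    rw [this]; push_cast; ring
  · rfl

/-! ### Dipoles -/

theorem dipoleSign_dipole {m : ℕ} (hm : Odd m) :
    dipoleSign (dipoleFrame m).orientation (dipoleFrame m) = 1 := by
  have hE : Fintype.card (dipole m).E = m := Fintype.card_fin m
  have hV : Fintype.card (dipole m).V = 2 := Fintype.card_fin 2
  rw [dipoleSign, dif_pos ⟨hV, by rw [hE]; exact hm⟩]
  have h1 : (dipoleFrame m).orientation.coeff (dipoleFrame m) = 1 := by
    simp [Frame.orientation, relSign]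
  rw [h1, Finset.prod_eq_one]
  · rfl
  · intro e _
    rfl

theorem canonicalIntegral_dipole (i : ℕ) :
    canonicalIntegral (dipole (2 * i + 1)) (dipoleFrame (2 * i + 1)).orientation = 1 := by
  rw [canonicalIntegral_eq (dipole_connected _ (by omega)) _ (dipoleFrame _),
    dipoleSign_dipole ⟨i, rfl⟩, Int.cast_one]

/-- Incidences of an edge sum to zero, so every edge has both vertices as ends, and a half-edge is
determined by its edge and its vertex. -/
theorem nonempty_iso_dipole (hV : Fintype.card G.V = 2) (q : Fin (Fintype.card G.V) ≃ G.V)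
    (t : G.Direction) (h : ∀ e, incidence t (q ⟨1, by omega⟩) e ≠ 0) :
    Nonempty (Iso G (dipole (Fintype.card G.E))) := by
  have h0 : ∀ e, incidence t (q ⟨0, by omega⟩) e ≠ 0 := fun e => by
    rw [incidence_zero_one hV]; exact neg_ne_zero.2 (h e)
  have hne : q ⟨0, by omega⟩ ≠ q ⟨1, by omega⟩ := by simp
  have hE := fun x => endpoints t hne (h0 (G.edge x)) (h (G.edge x))
  have hvert : ∀ x, G.vert (G.flip x) ≠ G.vert x := by
    intro x
    rcases hE x with ⟨h1, h2⟩ | ⟨h1, h2⟩ <;> rw [h1, h2]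
    · exact hne.symm
    · exact hne
  let eV : G.V ≃ Fin 2 := q.symm.trans (finCongr hV)
  let eE : G.E ≃ Fin (Fintype.card G.E) := Fintype.equivFin G.E
  have hbij : Function.Bijective fun x : G.H => (eE (G.edge x), eV (G.vert x)) := by
    constructor
    · intro x y hxy
      have h1 := eE.injective (congrArg Prod.fst hxy)
      have h2 := eV.injective (congrArg Prod.snd hxy)
      rcases (G.edge_eq_iff _ _).1 h1 with h3 | h3
      · exact h3.symm
      · rw [h3] at h2
        exact absurd h2.symm (hvert x)
    · rintro ⟨e, s⟩
      obtain ⟨x, hx⟩ := G.edge_surj (eE.symm e)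
      have hcase : ∀ a b c : Fin 2, a ≠ b → c = a ∨ c = b := by decide
      rcases hcase (eV (G.vert (G.flip x))) (eV (G.vert x)) s
        (fun h => hvert x (eV.injective h)) with h1 | h1
      · exact ⟨G.flip x, Prod.ext (by simp [edge_flip, hx]) h1.symm⟩
      · exact ⟨x, Prod.ext (by simp [hx]) h1.symm⟩
  exact ⟨{
    onV := eV
    onE := eE
    onH := Equiv.ofBijective _ hbij
    vert_onH := fun _ => rfl
    edge_onH := fun _ => rfl }⟩

theorem canonicalIntegral_ne_zero_imp (hG : G.Connected) (o : Orientation G)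
    (h : canonicalIntegral G o ≠ 0) : ∃ i : ℕ, Nonempty (Iso G (dipole (2 * i + 1))) := by
  obtain ⟨d⟩ := nonempty_frame G
  rw [canonicalIntegral_eq hG o d] at h
  have h : dipoleSign o d ≠ 0 := by exact_mod_cast h
  unfold dipoleSign at h
  split_ifs at h with h1
  · obtain ⟨i, hi⟩ := h1.2
    refine ⟨i, ?_⟩
    have h2 := Finset.prod_ne_zero_iff.1 (right_ne_zero_of_mul h)
    have h3 := nonempty_iso_dipole h1.1 d.order d.dir fun e => h2 e (Finset.mem_univ e)
    rwa [hi] at h3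
  · exact absurd rfl h

theorem canonicalIntegral_of_iso_dipole (hG : G.Connected) (o : Orientation G) {i : ℕ}
    (φ : Iso G (dipole (2 * i + 1))) :
    canonicalIntegral G o = 1 ∨ canonicalIntegral G o = -1 := by
  obtain ⟨d⟩ := nonempty_frame G
  have h1 := φ.coeff_mul_dipoleSign (φ.mapsFrame_mapFrame d) o
    (dipoleFrame (2 * i + 1)).orientation
  have h2 := canonicalIntegral_dipole i
  rw [canonicalIntegral_eq (dipole_connected _ (by omega)) _ (φ.mapFrame d)] at h2
  rw [canonicalIntegral_eq hG o d]
  have h2 : dipoleSign (dipoleFrame (2 * i + 1)).orientation (φ.mapFrame d) = 1 := by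
    exact_mod_cast h2
  rw [h2] at h1
  have h4 : IsUnit ((((dipoleFrame (2 * i + 1)).orientation.coeff (φ.mapFrame d) : ℤˣ) : ℤ) *
      dipoleSign o d) := by
    rw [← h1, mul_one]; exact Units.isUnit _
  have h3 : dipoleSign o d = 1 ∨ dipoleSign o d = -1 :=
    Int.isUnit_iff.1 (isUnit_of_mul_isUnit_right h4)
  rcases h3 with h3 | h3 <;> simp [h3]

theorem loops_dipole (m : ℕ) : (dipole (m + 1)).loops = m := by
  obtain ⟨p⟩ := (dipole_connected (m + 1) (by omega)).nonempty_presentation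
  have h := p.loops_add_card (N := 1) rfl
  have hE : Fintype.card (dipole (m + 1)).E = m + 1 := Fintype.card_fin _
  omega

/-- Vertices and edges can be permuted independently, and the action on half-edges is then
determined. -/
theorem autCard_dipole (m : ℕ) : autCard (dipole (m + 1)) = 2 * (m + 1).factorial := by
  have e : Iso (dipole (m + 1)) (dipole (m + 1)) ≃
      Equiv.Perm (Fin 2) × Equiv.Perm (Fin (m + 1)) :=
    { toFun := fun φ => (φ.onV, φ.onE)
      invFun := fun x =>
        { onV := x.1
          onE := x.2
          onH := Equiv.prodCongr x.2 x.1
          vert_onH := fun _ => rfl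
          edge_onH := fun _ => rfl }
      left_inv := fun φ => by
        have h : ∀ x, (φ.onE x.1, φ.onV x.2) = φ.onH x := fun x =>
          Prod.ext (φ.edge_onH x).symm (φ.vert_onH x).symm
        ext x
        · rfl
        · rfl
        · exact h x
      right_inv := fun _ => rfl }
  rw [autCard, Nat.card_congr e, Nat.card_prod, Nat.card_perm, Nat.card_perm]
  simp

end HGraph

end OddGC

namespace OddGC

open HGraph

/-! ### The pairing with the dipole sum -/

namespace OrGraph

theorem integral_neg {X : OrGraph} (hX : X.graph.Connected) : (-X).integral = -X.integral :=
  canonicalIntegral_neg hX X.orient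

theorem integral_eq_of_isoTo {X Y : OrGraph} (hX : X.graph.Connected) (h : X.IsoTo Y) :
    X.integral = Y.integral := by
  obtain ⟨φ, hφ⟩ := h
  exact canonicalIntegral_eq_of_iso hX φ hφ

theorem integral_dipole (i : ℕ) : (dipole (2 * i + 1)).integral = 1 := canonicalIntegral_dipole i

theorem isoTo_dipole_of_integral_eq_one {X : OrGraph} (hX : X.graph.Connected)
    (h : X.integral = 1) : ∃ i : ℕ, X.IsoTo (dipole (2 * i + 1)) := by
  obtain ⟨i, ⟨φ⟩⟩ := canonicalIntegral_ne_zero_imp hX X.orient (h.trans_ne one_ne_zero)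
  exact ⟨i, φ, mapsOrientation_of_canonicalIntegral_eq hX φ (h.trans (integral_dipole i).symm)
    (h.trans_ne one_ne_zero)⟩

theorem integral_cases {X : OrGraph} (hX : X.graph.Connected) :
    X.integral = 0 ∨ X.integral = 1 ∨ X.integral = -1 := by
  by_cases h : X.integral = 0
  · exact Or.inl h
  · obtain ⟨i, ⟨φ⟩⟩ := canonicalIntegral_ne_zero_imp hX X.orient h
    exact Or.inr (canonicalIntegral_of_iso_dipole hX X.orient φ)

end OrGraph

/-- The canonical integral on the graph complex. -/
def integralMap : GC →ₗ[ℚ] ℝ :=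
  GC.lift (fun X => X.1.integral) (fun X _ h => OrGraph.integral_eq_of_isoTo X.2.1 h)
    (fun X => OrGraph.integral_neg X.2.1)

theorem integralMap_cls (X : Generator) : integralMap (cls X) = X.1.integral :=
  GC.lift_cls _ _ _ X

open Classical in
/-- The canonical integral on graphs with `m` edges. -/
def integralMapOfCard (m : ℕ) : GC →ₗ[ℚ] ℝ :=
  GC.lift (fun X => if Fintype.card X.1.graph.E = m then X.1.integral else 0)
    (fun X Y h => by
      obtain ⟨φ, hφ⟩ := id h
      rw [OrGraph.integral_eq_of_isoTo X.2.1 h, Fintype.card_congr φ.onE])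
    (fun X => by
      have h1 : (-X).1.integral = -X.1.integral := OrGraph.integral_neg X.2.1
      have h2 : Fintype.card (-X).1.graph.E = Fintype.card X.1.graph.E := rfl
      rw [h1, h2]
      split_ifs <;> simp)

theorem integralMapOfCard_cls (m : ℕ) (X : Generator) [Decidable (Fintype.card X.1.graph.E = m)] :
    integralMapOfCard m (cls X) = if Fintype.card X.1.graph.E = m then X.1.integral else 0 := by
  rw [integralMapOfCard, GC.lift_cls]
  congr

theorem card_edges_oddDipole (i : ℕ) :
    Fintype.card (Generator.oddDipole i).1.graph.E = 2 * i + 3 := Fintype.card_fin _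

theorem integral_oddDipole (i : ℕ) : (Generator.oddDipole i).1.integral = 1 :=
  OrGraph.integral_dipole (i + 1)

theorem integralMapOfCard_oddDipole (i : ℕ) :
    integralMapOfCard (2 * i + 3) (cls (Generator.oddDipole i)) = 1 := by
  rw [integralMapOfCard_cls, if_pos (card_edges_oddDipole i), integral_oddDipole]

theorem isoTo_oddDipole {X : OrGraph} (hX : X.graph.Connected) (h : X.integral = 1) {i : ℕ}
    (hm : Fintype.card X.graph.E = 2 * i + 3) : X.IsoTo (Generator.oddDipole i).1 := by
  obtain ⟨j, hj⟩ := OrGraph.isoTo_dipole_of_integral_eq_one hX h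
  have h1 : Fintype.card X.graph.E = 2 * j + 1 := by
    obtain ⟨φ, -⟩ := hj
    exact (Fintype.card_congr φ.onE).trans (Fintype.card_fin _)
  obtain rfl : j = i + 1 := by omega
  exact hj

theorem pairing_cls (X Y : Generator) : pairing (cls X) (cls Y) = graphPairing X Y := by
  rw [pairing, GC.lift_cls, pairingRight, GC.lift_cls]

/-- Classes ±D have integral ±1. Conversely, a generator with integral ±1 and the right number of
edges is isomorphic to the dipole up to sign. The factor is the order of the automorphism group. -/
theorem pairing_oddDipole (i : ℕ) (X : Generator) :
    (pairing (cls (Generator.oddDipole i)) (cls X) : ℝ) =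
      2 * ((2 * i + 3).factorial : ℝ) * integralMapOfCard (2 * i + 3) (cls X) := by
  have hD := integralMapOfCard_oddDipole i
  -- The integral, being well defined on classes, detects that the dipole does not vanish in the
  -- graph complex.
  have hne : cls (Generator.oddDipole i) ≠ 0 := fun h => by
    rw [h, map_zero] at hD; exact zero_ne_one hD
  have haut : (Generator.oddDipole i).1.graph.autCard = 2 * (2 * i + 3).factorial :=
    autCard_dipole (2 * i + 2)
  rw [pairing_cls, graphPairing]
  by_cases h1 : cls (Generator.oddDipole i) = cls X
  · rw [if_pos ⟨h1, hne⟩, ← h1, hD, haut]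
    push_cast; ring
  rw [if_neg fun h => h1 h.1]
  by_cases h2 : cls (Generator.oddDipole i) = -cls X
  · have h3 : cls X = -cls (Generator.oddDipole i) := by rw [h2, neg_neg]
    rw [if_pos ⟨h2, hne⟩, h3, map_neg, hD, haut]
    push_cast; ring
  rw [if_neg fun h => h2 h.1, integralMapOfCard_cls]
  split_ifs with h3
  · rcases OrGraph.integral_cases X.2.1 with h4 | h4 | h4
    · simp [h4]
    · exact absurd (cls_eq_of_iso (X := X) (isoTo_oddDipole X.2.1 h4 h3)).symm h1
    · have h5 : (-X).1.integral = 1 := by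
        have : (-X).1.integral = -X.1.integral := OrGraph.integral_neg X.2.1
        rw [this, h4, neg_neg]
      have h6 := cls_eq_of_iso (X := -X) (isoTo_oddDipole (X := (-X).1) X.2.1 h5 h3)
      rw [cls_neg] at h6
      exact absurd h6.symm h2
  · simp

/-! ### Bidegrees and the infinite dipole sum -/

theorem bidegree_oddDipole_injective :
    Function.Injective fun i => (Generator.oddDipole i).bidegree := by
  intro i j h
  have h1 : ∀ i, (Generator.oddDipole i).bidegree.1 = 2 * i + 2 := fun i =>
    loops_dipole (2 * i + 2)
  have h2 := congrArg Prod.fst h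
  simp only [h1] at h2
  omega

/-- The dipoles have different loop numbers, so only one term of the sum lives in this bidegree. -/
theorem MCdip_bidegree (i : ℕ) : (MCdip (Generator.oddDipole i).bidegree : GC) =
    (1 / (2 * (Nat.factorial (2 * i + 3) : ℚ))) • cls (Generator.oddDipole i) := by
  unfold MCdip
  rw [finsum_eq_single _ i]
  · simp [Generator.cochain]
  · intro j hj
    rw [Generator.cochain, Pi.single_eq_of_ne, smul_zero]
    exact fun h => hj (bidegree_oddDipole_injective h.symm)

theorem MCdip_of_forall_ne {q : ℕ × ℤ} (h : ∀ i, q ≠ (Generator.oddDipole i).bidegree) :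
    MCdip q = 0 := by
  unfold MCdip
  rw [finsum_eq_zero_of_forall_eq_zero]
  intro i
  rw [Generator.cochain, Pi.single_eq_of_ne (h i), smul_zero]

theorem pairing_MCdip_bidegree (i : ℕ) (X : Generator) :
    (pairing (MCdip (Generator.oddDipole i).bidegree : GC) (cls X) : ℝ) =
      integralMapOfCard (2 * i + 3) (cls X) := by
  rw [MCdip_bidegree, map_smul, LinearMap.smul_apply, smul_eq_mul, Rat.cast_mul,
    pairing_oddDipole]
  have : ((2 * i + 3).factorial : ℝ) ≠ 0 := by exact_mod_cast (Nat.factorial_pos _).ne'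
  push_cast
  field_simp

theorem support_pairing_MCdip_cls (X : Generator) {i : ℕ} {q : ℕ × ℤ}
    (hi : Fintype.card X.1.graph.E = 2 * i + 3) (hq : q ≠ (Generator.oddDipole i).bidegree) :
    pairing (MCdip q : GC) (cls X) = 0 := by
  by_cases h : ∃ j, q = (Generator.oddDipole j).bidegree
  · obtain ⟨j, rfl⟩ := h
    have h1 := pairing_MCdip_bidegree j X
    rw [integralMapOfCard_cls, if_neg] at h1
    · exact_mod_cast h1
    · rintro h2
      obtain rfl : i = j := by omega
      exact hq rfl
  · push Not at h
    rw [MCdip_of_forall_ne h]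
    simp

theorem pairing_MCdip_cls_eq_zero (X : Generator) (hX : X.1.integral = 0) (q : ℕ × ℤ) :
    pairing (MCdip q : GC) (cls X) = 0 := by
  by_cases h : ∃ j, q = (Generator.oddDipole j).bidegree
  · obtain ⟨j, rfl⟩ := h
    have h1 := pairing_MCdip_bidegree j X
    rw [integralMapOfCard_cls, hX, ite_self] at h1
    exact_mod_cast h1
  · push Not at h
    rw [MCdip_of_forall_ne h]
    simp

theorem exists_card_eq (X : Generator) (hX : X.1.integral ≠ 0) :
    ∃ i, Fintype.card X.1.graph.E = 2 * i + 3 := by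
  obtain ⟨j, ⟨φ⟩⟩ := canonicalIntegral_ne_zero_imp X.2.1 X.1.orient hX
  have h1 : Fintype.card X.1.graph.E = 2 * j + 1 :=
    (Fintype.card_congr φ.onE).trans (Fintype.card_fin _)
  -- The single edge D₁ has vertices of valence one and is excluded by the valence condition.
  rcases j with _ | i
  · obtain ⟨v⟩ := X.2.1.1
    have h2 := X.2.2 v
    have h3 := Fintype.card_congr (Equiv.subtypeEquiv φ.onH
      (p := fun h => X.1.graph.vert h = v)
      (q := fun h => (HGraph.dipole (2 * 0 + 1)).vert h = φ.onV v) fun h => by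
        rw [φ.vert_onH, EmbeddingLike.apply_eq_iff_eq])
    have h4 : X.1.graph.valence v = (HGraph.dipole (2 * 0 + 1)).valence (φ.onV v) := h3
    rw [dipole_valence] at h4
    omega
  · exact ⟨i, by omega⟩

theorem cochainPairing_cls (X : Generator) :
    (Function.support fun q => pairing (MCdip q : GC) (cls X)).Finite ∧
      X.1.integral = (cochainPairing MCdip (cls X) : ℝ) := by
  unfold cochainPairing
  by_cases hX : X.1.integral = 0
  · have h0 : (fun q => pairing (MCdip q : GC) (cls X)) = 0 :=
      funext fun q => pairing_MCdip_cls_eq_zero X hX q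
    constructor
    · rw [h0, Function.support_zero]; exact Set.finite_empty
    · rw [hX, finsum_eq_zero_of_forall_eq_zero (congrFun h0), Rat.cast_zero]
  · obtain ⟨i, hi⟩ := exists_card_eq X hX
    constructor
    · refine (Set.finite_singleton (Generator.oddDipole i).bidegree).subset fun q hq => ?_
      by_contra h
      exact hq (support_pairing_MCdip_cls X hi h)
    · rw [finsum_eq_single _ (Generator.oddDipole i).bidegree
        fun q hq => support_pairing_MCdip_cls X hi hq, pairing_MCdip_bidegree,
        integralMapOfCard_cls, if_pos hi]

/-- Finiteness of the support is carried through the induction because `finsum` is additive only for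
finite supports. -/
theorem integralMap_eq_cochainPairing (x : GC) :
    (Function.support fun q => pairing (MCdip q : GC) x).Finite ∧
      integralMap x = (cochainPairing MCdip x : ℝ) := by
  obtain ⟨y, rfl⟩ : ∃ y, GC.mk y = x := Submodule.mkQ_surjective relations x
  induction y using Finsupp.induction_linear with
  | zero => simp [cochainPairing]
  | add f g hf hg =>
    obtain ⟨hf, hf'⟩ := hf
    obtain ⟨hg, hg'⟩ := hg
    simp only [map_add]
    refine ⟨(hf.union hg).subset (Function.support_add _ _), ?_⟩
    rw [hf', hg', ← Rat.cast_add]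
    congr 1
    unfold cochainPairing
    rw [← finsum_add_distrib hf hg]
    simp only [map_add]
  | single X r =>
    have h0 : GC.mk (Finsupp.single X r) = r • cls X := by
      rw [cls, ← map_smul, Finsupp.smul_single, smul_eq_mul, mul_one]
    obtain ⟨hf, hf'⟩ := cochainPairing_cls X
    rw [h0]
    simp only [map_smul]
    refine ⟨hf.subset (Function.support_const_smul_subset r _), ?_⟩
    rw [integralMap_cls, hf']
    unfold cochainPairing
    simp only [map_smul]
    rw [← smul_finsum, Rat.smul_def, smul_eq_mul, Rat.cast_mul]

end OddGC

end

/-! ### The main theorem -/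

theorem corollary5p3 :
    -- absolute convergence, for every graph, connected or not, and all choices
    (∀ (G : OddGC.HGraph) (ε : G.EdgeOrder) (t : G.Direction) (C : G.CycleBasis),
      MeasureTheory.IntegrableOn (OddGC.HGraph.integrand ε t C) G.simplex MeasureTheory.volume) ∧
    -- the integral of a connected oriented graph is defined, and independent of all choices
    (∀ X : OddGC.OrGraph, X.graph.Connected →
      Nonempty (OddGC.HGraph.Presentation X.graph) ∧
      ∀ p : OddGC.HGraph.Presentation X.graph,
        (p.sign X.orient = 1 ∨ p.sign X.orient = -1) ∧ p.value X.orient = X.integral) ∧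
    -- it induces a linear function on the graph complex, the pairing with the dipole sum
    (∃ I : OddGC.GC →ₗ[ℚ] ℝ,
      (∀ X : OddGC.Generator, I (OddGC.cls X) = X.1.integral) ∧
      ∀ x : OddGC.GC, I x = (OddGC.cochainPairing OddGC.MCdip x : ℝ)) ∧
    -- values on all connected oriented graphs
    (∀ X : OddGC.OrGraph, X.graph.Connected →
      ((∃ i : ℕ, X.IsoTo (OddGC.OrGraph.dipole (2 * i + 1))) → X.integral = 1) ∧
      ((∃ i : ℕ, (-X).IsoTo (OddGC.OrGraph.dipole (2 * i + 1))) → X.integral = -1) ∧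
      ((X.integral = 1 ∨ X.integral = -1) ↔
        ∃ i : ℕ, Nonempty (OddGC.HGraph.Iso X.graph (OddGC.HGraph.dipole (2 * i + 1)))) ∧
      ((¬ ∃ i : ℕ, Nonempty (OddGC.HGraph.Iso X.graph (OddGC.HGraph.dipole (2 * i + 1)))) →
        X.integral = 0)) ∧
    -- vanishing for disconnected graphs without isolated vertices
    (∀ G : OddGC.HGraph, (∀ v : G.V, ∃ h, G.vert h = v) → ¬ G.Connected →
      ∀ (ε : G.EdgeOrder) (t : G.Direction) (C : G.CycleBasis),
        OddGC.HGraph.pfIntegral ε t C = 0) := by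
  refine ⟨fun _ => OddGC.HGraph.integrableOn_integrand, fun X hX => ⟨hX.nonempty_presentation, fun p =>
    ⟨p.sign_cases hX X.orient, p.value_eq_canonicalIntegral hX X.orient⟩⟩,
    ⟨OddGC.integralMap, OddGC.integralMap_cls, fun x =>
      (OddGC.integralMap_eq_cochainPairing x).2⟩, fun X hX => ⟨?_, ?_, ?_, ?_⟩,
    fun G hG hc => OddGC.HGraph.pfIntegral_of_not_connected hG hc⟩
  · rintro ⟨i, hi⟩
    rw [OddGC.OrGraph.integral_eq_of_isoTo hX hi, OddGC.OrGraph.integral_dipole]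
  · rintro ⟨i, hi⟩
    have h := OddGC.OrGraph.integral_eq_of_isoTo (X := -X) hX hi
    rw [OddGC.OrGraph.integral_neg hX, OddGC.OrGraph.integral_dipole] at h
    rw [← h, neg_neg]
  · refine ⟨fun h => OddGC.HGraph.canonicalIntegral_ne_zero_imp hX X.orient ?_, ?_⟩
    · have h : X.integral ≠ 0 := by rcases h with h | h <;> rw [h] <;> norm_num
      exact h
    · rintro ⟨i, ⟨φ⟩⟩
      exact OddGC.HGraph.canonicalIntegral_of_iso_dipole hX X.orient φ
  · intro h
    by_contra h0
    exact h (OddGC.HGraph.canonicalIntegral_ne_zero_imp hX X.orient h0)
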